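/- Let $\mathfrak h$ be a finite-dimensional complex Hilbert space (inner products are linear in the second argument), let $L:\mathfrak h\to\mathfrak h$ be a symmetric linear operator, $w\in\mathfrak h$ and $\theta\in\mathbb R$. Write $\mathbb R_+=(0,\infty)$, let $H^1(\mathbb R_+)=\{\phi\in L^2(\mathbb R_+;\mathbb C):\phi'\in L^2(\mathbb R_+;\mathbb C)\}$ and $H^2(\mathbb R_+)=\{\phi\in H^1(\mathbb R_+):\phi'\in H^1(\mathbb R_+)\}$, with derivatives in the sense of distributions, and for $\phi\in H^1(\mathbb R_+)$ let $\phi(0_+)$ be the limit at $0$ of its continuous representative. On $L^2(\mathbb R_+)\oplus\mathfrak h$ consider the operator $$A(\phi,y)=(\phi'',\,Ly+\phi'(0_+)\,w),\qquad D(A)=\{(\phi,y)\in H^2(\mathbb R_+)\oplus\mathfrak h:\ \theta\phi'(0_+)+\phi(0_+)=\langle w,y\rangle\}.$$ Then $A$ is self-adjoint and $-A$ is bounded from below. Let $Q$ be the quadratic form of $-A$, that is, the closure of the form $\Psi\mapsto\langle\Psi,-A\Psi\rangle$ defined on $D(A)$: $\Psi\in D(Q)$ if and only if there are $\Psi_n\in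 D(A)$ with $\Psi_n\to\Psi$, $\langle\Psi_n-\Psi_m,-A(\Psi_n-\Psi_m)\rangle\to0$ as $n,m\to\infty$ and $\langle\Psi_n,-A\Psi_n\rangle$ convergent, and then $Q(\Psi)=\lim_n\langle\Psi_n,-A\Psi_n\rangle$. This $Q$ is well defined and closed (if $\Psi_n\in D(Q)$, $\Psi_n\to\Psi$ and $Q(\Psi_n-\Psi_m)\to0$ as $n,m\to\infty$, then $\Psi\in D(Q)$ and $Q(\Psi_n-\Psi)\to0$), and it is given as follows. 1. If $\theta=0$, then $D(Q)=\{(\phi,y)\in H^1(\mathbb R_+)\oplus\mathfrak h:\ \phi(0_+)=\langle w,y\rangle\}$ and $Q(\phi,y)=\|\phi'\|_2^2-\langle Ly,y\rangle$ for $(\phi,y)\in D(Q)$. 2. If $\theta\neq0$, then $D(Q)=H^1(\mathbb R_+)\oplus\mathfrak h$ and $Q(\phi,y)=\|\phi'\|_2^2-\langle Ly,y\rangle-\dfrac1\theta\,|\phi(0_+)-\langle w,y\rangle|^2$ for $(\phi,y)\in D(Q)$. -/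

import Mathlib

open MeasureTheory Set Filter Topology
open scoped ContDiff ENNReal

noncomputable section

namespace Lamb

/-! ### Sobolev spaces on the half line -/

/-- The complex Hilbert space of square integrable functions on `(0, ∞)`. -/
abbrev L2 : Type := Lp ℂ 2 (volume.restrict (Ioi (0 : ℝ)))

/-- `ψ` is the derivative of `φ` in the sense of distributions on the open half line. -/
def HasWeakDeriv (φ ψ : L2) : Prop :=
  ∀ f : ℝ → ℝ, ContDiff ℝ ∞ f → HasCompactSupport f → tsupport f ⊆ Ioi 0 →
    ∫ x in Ioi (0 : ℝ), deriv f x • φ x = -∫ x in Ioi (0 : ℝ), f x • ψ x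

lemma L2.locallyIntegrable (φ : L2) :
    LocallyIntegrable (fun x => φ x) (volume.restrict (Ioi (0 : ℝ))) :=
  (Lp.memLp φ).locallyIntegrable (by norm_num)

lemma L2.integrable_smul (φ : L2) {f : ℝ → ℝ} (hf : Continuous f) (hc : HasCompactSupport f) :
    Integrable (fun x => f x • φ x) (volume.restrict (Ioi (0 : ℝ))) :=
  φ.locallyIntegrable.integrable_smul_left_of_hasCompactSupport hf hc

lemma ae_zero_of_test {u : ℝ → ℂ} (hu : LocallyIntegrable u (volume.restrict (Ioi (0 : ℝ))))
    (h : ∀ f : ℝ → ℝ, ContDiff ℝ ∞ f → HasCompactSupport f → tsupport f ⊆ Ioi 0 →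
      ∫ x in Ioi (0 : ℝ), f x • u x = 0) :
    ∀ᵐ x ∂(volume.restrict (Ioi (0 : ℝ))), u x = 0 := by
  have h1 := isOpen_Ioi.ae_eq_zero_of_integral_contDiff_smul_eq_zero
    (μ := volume.restrict (Ioi (0 : ℝ))) (hu.locallyIntegrableOn (Ioi (0 : ℝ))) h
  filter_upwards [h1, ae_restrict_mem measurableSet_Ioi] with x hx hx0 using hx hx0

lemma HasWeakDeriv.unique {φ ψ₁ ψ₂ : L2} (h₁ : HasWeakDeriv φ ψ₁) (h₂ : HasWeakDeriv φ ψ₂) :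
    ψ₁ = ψ₂ := by
  have key := ae_zero_of_test (u := fun x => ψ₁ x - ψ₂ x)
    (ψ₁.locallyIntegrable.sub ψ₂.locallyIntegrable) (by
      intro f hf hc hs
      simp only [smul_sub]
      rw [integral_sub (ψ₁.integrable_smul hf.continuous hc)
        (ψ₂.integrable_smul hf.continuous hc)]
      have e := (h₁ f hf hc hs).symm.trans (h₂ f hf hc hs)
      rw [neg_inj.mp e, sub_self])
  apply Lp.ext
  filter_upwards [key] with x hx using sub_eq_zero.mp hx

lemma HasWeakDeriv.add {φ₁ φ₂ ψ₁ ψ₂ : L2} (h₁ : HasWeakDeriv φ₁ ψ₁)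
    (h₂ : HasWeakDeriv φ₂ ψ₂) : HasWeakDeriv (φ₁ + φ₂) (ψ₁ + ψ₂) := by
  intro f hf hc hs
  have hd : Continuous (deriv f) := hf.continuous_deriv (by simp)
  have e1 : ∫ x in Ioi (0 : ℝ), deriv f x • (φ₁ + φ₂ : L2) x
      = ∫ x in Ioi (0 : ℝ), (deriv f x • φ₁ x + deriv f x • φ₂ x) := by
    apply integral_congr_ae
    filter_upwards [Lp.coeFn_add φ₁ φ₂] with x hx
    rw [hx, Pi.add_apply, smul_add]
  have e2 : ∫ x in Ioi (0 : ℝ), f x • (ψ₁ + ψ₂ : L2) x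
      = ∫ x in Ioi (0 : ℝ), (f x • ψ₁ x + f x • ψ₂ x) := by
    apply integral_congr_ae
    filter_upwards [Lp.coeFn_add ψ₁ ψ₂] with x hx
    rw [hx, Pi.add_apply, smul_add]
  rw [e1, e2, integral_add (φ₁.integrable_smul hd hc.deriv) (φ₂.integrable_smul hd hc.deriv),
    integral_add (ψ₁.integrable_smul hf.continuous hc) (ψ₂.integrable_smul hf.continuous hc),
    h₁ f hf hc hs, h₂ f hf hc hs, neg_add]

lemma HasWeakDeriv.smul {φ ψ : L2} (c : ℂ) (h : HasWeakDeriv φ ψ) :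
    HasWeakDeriv (c • φ) (c • ψ) := by
  intro f hf hc hs
  have e1 : ∫ x in Ioi (0 : ℝ), deriv f x • (c • φ : L2) x
      = ∫ x in Ioi (0 : ℝ), c • (deriv f x • φ x) := by
    apply integral_congr_ae
    filter_upwards [Lp.coeFn_smul c φ] with x hx
    rw [hx, Pi.smul_apply, smul_comm]
  have e2 : ∫ x in Ioi (0 : ℝ), f x • (c • ψ : L2) x
      = ∫ x in Ioi (0 : ℝ), c • (f x • ψ x) := by
    apply integral_congr_ae
    filter_upwards [Lp.coeFn_smul c ψ] with x hx
    rw [hx, Pi.smul_apply, smul_comm]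
  rw [e1, e2, integral_smul, integral_smul, h f hf hc hs, smul_neg]

lemma hasWeakDeriv_zero : HasWeakDeriv 0 0 := by
  intro f _ _ _
  have h0 := Lp.coeFn_zero ℂ 2 (volume.restrict (Ioi (0 : ℝ)))
  have e (g : ℝ → ℝ) : ∫ x in Ioi (0 : ℝ), g x • (0 : L2) x = 0 := by
    apply integral_eq_zero_of_ae
    filter_upwards [h0] with x hx
    rw [hx]
    simp
  rw [e, e, neg_zero]

/-- The Sobolev space `H¹` of the half line. -/
def H1 : Submodule ℂ L2 where
  carrier := {φ | ∃ ψ, HasWeakDeriv φ ψ}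
  zero_mem' := ⟨0, hasWeakDeriv_zero⟩
  add_mem' := fun ⟨ψ₁, h₁⟩ ⟨ψ₂, h₂⟩ => ⟨ψ₁ + ψ₂, h₁.add h₂⟩
  smul_mem' := fun c _ ⟨ψ, h⟩ => ⟨c • ψ, h.smul c⟩

open Classical in
/-- The weak derivative of an element of `H1` (and `0` for other elements of `L2`). -/
def weakDeriv (φ : L2) : L2 := if h : ∃ ψ, HasWeakDeriv φ ψ then h.choose else 0

lemma hasWeakDeriv_weakDeriv {φ : L2} (h : φ ∈ H1) : HasWeakDeriv φ (weakDeriv φ) := by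
  have h' : ∃ ψ, HasWeakDeriv φ ψ := h
  rw [weakDeriv, dif_pos h']
  exact h'.choose_spec

lemma HasWeakDeriv.weakDeriv_eq {φ ψ : L2} (h : HasWeakDeriv φ ψ) : weakDeriv φ = ψ :=
  (hasWeakDeriv_weakDeriv ⟨ψ, h⟩).unique h

lemma weakDeriv_add {φ₁ φ₂ : L2} (h₁ : φ₁ ∈ H1) (h₂ : φ₂ ∈ H1) :
    weakDeriv (φ₁ + φ₂) = weakDeriv φ₁ + weakDeriv φ₂ :=
  ((hasWeakDeriv_weakDeriv h₁).add (hasWeakDeriv_weakDeriv h₂)).weakDeriv_eq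

lemma weakDeriv_smul (c : ℂ) {φ : L2} (h : φ ∈ H1) :
    weakDeriv (c • φ) = c • weakDeriv φ :=
  ((hasWeakDeriv_weakDeriv h).smul c).weakDeriv_eq

lemma weakDeriv_zero : weakDeriv 0 = 0 := hasWeakDeriv_zero.weakDeriv_eq

/-- The Sobolev space `H²` of the half line. -/
def H2 : Submodule ℂ L2 where
  carrier := {φ | φ ∈ H1 ∧ weakDeriv φ ∈ H1}
  zero_mem' := ⟨H1.zero_mem, by rw [weakDeriv_zero]; exact H1.zero_mem⟩
  add_mem' := fun ⟨a, a'⟩ ⟨b, b'⟩ =>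
    ⟨H1.add_mem a b, by rw [weakDeriv_add a b]; exact H1.add_mem a' b'⟩
  smul_mem' := fun c _ ⟨a, a'⟩ =>
    ⟨H1.smul_mem c a, by rw [weakDeriv_smul c a]; exact H1.smul_mem c a'⟩

/-! ### Boundary values -/

/-- `a` is the limit at `0+` of the continuous representative of `φ`. -/
def HasTrace (φ : L2) (a : ℂ) : Prop :=
  ∃ g : ℝ → ℂ, ContinuousOn g (Ioi 0) ∧ (∀ᵐ x, x ∈ Ioi (0 : ℝ) → φ x = g x) ∧
    Tendsto g (𝓝[>] 0) (𝓝 a)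

lemma HasTrace.unique {φ : L2} {a b : ℂ} (ha : HasTrace φ a) (hb : HasTrace φ b) : a = b := by
  obtain ⟨g, gc, hg, ga⟩ := ha
  obtain ⟨k, kc, hk, kb⟩ := hb
  have hgk : EqOn g k (Ioi 0) := by
    refine Measure.eqOn_open_of_ae_eq (μ := volume) ?_ isOpen_Ioi gc kc
    rw [Filter.EventuallyEq, ae_restrict_iff' measurableSet_Ioi]
    filter_upwards [hg, hk] with x h1 h2 hx
    rw [← h1 hx, h2 hx]
  refine tendsto_nhds_unique ga (kb.congr' ?_)
  filter_upwards [self_mem_nhdsWithin] with x hx using (hgk hx).symm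

lemma HasTrace.add {φ₁ φ₂ : L2} {a b : ℂ} (ha : HasTrace φ₁ a) (hb : HasTrace φ₂ b) :
    HasTrace (φ₁ + φ₂) (a + b) := by
  obtain ⟨g, gc, hg, ga⟩ := ha
  obtain ⟨k, kc, hk, kb⟩ := hb
  refine ⟨g + k, gc.add kc, ?_, ga.add kb⟩
  have h := (ae_restrict_iff' measurableSet_Ioi).mp (Lp.coeFn_add φ₁ φ₂)
  filter_upwards [hg, hk, h] with x h1 h2 h3 hx
  rw [h3 hx, Pi.add_apply, Pi.add_apply, h1 hx, h2 hx]

lemma HasTrace.smul {φ : L2} {a : ℂ} (c : ℂ) (ha : HasTrace φ a) :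
    HasTrace (c • φ) (c • a) := by
  obtain ⟨g, gc, hg, ga⟩ := ha
  refine ⟨c • g, gc.const_smul c, ?_, ga.const_smul c⟩
  have h := (ae_restrict_iff' measurableSet_Ioi).mp (Lp.coeFn_smul c φ)
  filter_upwards [hg, h] with x h1 h3 hx
  rw [h3 hx, Pi.smul_apply, Pi.smul_apply, h1 hx]

lemma hasTrace_zero : HasTrace 0 0 := by
  refine ⟨0, continuousOn_const, ?_, tendsto_const_nhds⟩
  exact (ae_restrict_iff' measurableSet_Ioi).mp (Lp.coeFn_zero ℂ 2 _)

lemma L2.integrableOn_Ioc (ψ : L2) (x : ℝ) : IntegrableOn (fun t => ψ t) (Ioc 0 x) := by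
  have h := (ψ.locallyIntegrable.integrableOn_isCompact (isCompact_Icc (a := (0 : ℝ)) (b := x)))
  rw [IntegrableOn, Measure.restrict_restrict measurableSet_Icc] at h
  exact h.mono_measure (Measure.restrict_mono
    (show Ioc 0 x ⊆ Icc 0 x ∩ Ioi 0 from fun t ht => ⟨⟨ht.1.le, ht.2⟩, ht.1⟩) le_rfl)

lemma continuous_primitive (ψ : L2) : Continuous fun x : ℝ => ∫ t in Ioc 0 x, ψ t := by
  have hint : ∀ a b : ℝ,
      IntervalIntegrable ((Ioi (0 : ℝ)).indicator fun t => ψ t) volume a b := by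
    have h0 : ∀ a b : ℝ, IntegrableOn ((Ioi (0 : ℝ)).indicator fun t => ψ t) (Ioc a b) := by
      intro a b
      rw [IntegrableOn, integrable_indicator_iff measurableSet_Ioi, IntegrableOn,
        Measure.restrict_restrict measurableSet_Ioi]
      exact (ψ.integrableOn_Ioc b).mono_set
        (show Ioi 0 ∩ Ioc a b ⊆ Ioc 0 b from fun t ht => ⟨ht.1, ht.2.2⟩)
    exact fun a b => ⟨h0 a b, h0 b a⟩
  have hc := intervalIntegral.continuous_primitive hint 0
  refine hc.congr fun x => ?_
  rcases le_total 0 x with hx | hx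
  · rw [intervalIntegral.integral_of_le hx]
    refine setIntegral_congr_fun measurableSet_Ioc fun t ht => ?_
    exact indicator_of_mem (show t ∈ Ioi (0 : ℝ) from ht.1) _
  · rw [Ioc_eq_empty (not_lt.mpr hx), setIntegral_empty, intervalIntegral.integral_of_ge hx,
      neg_eq_zero]
    refine setIntegral_eq_zero_of_forall_eq_zero fun t ht => ?_
    exact indicator_of_notMem (fun h : (0 : ℝ) < t => absurd ht.2 (not_le.mpr h)) _

lemma exists_Icc_of_test {f : ℝ → ℝ} (hc : HasCompactSupport f) (hs : tsupport f ⊆ Ioi 0) :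
    ∃ ε R : ℝ, 0 < ε ∧ tsupport f ⊆ Icc ε R := by
  have hK : IsCompact (tsupport f ∪ {1}) := hc.isCompact.union isCompact_singleton
  obtain ⟨ε, hε⟩ := hK.exists_isLeast ⟨1, Or.inr rfl⟩
  obtain ⟨R, hR⟩ := hK.exists_isGreatest ⟨1, Or.inr rfl⟩
  refine ⟨ε, R, ?_, fun x hx => ⟨hε.2 (Or.inl hx), hR.2 (Or.inl hx)⟩⟩
  rcases hε.1 with h | h
  · exact hs h
  · rw [mem_singleton_iff.mp h]; exact one_pos

/-- Integration by parts against a primitive. -/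
lemma integral_deriv_smul_primitive (ψ : L2) {f : ℝ → ℝ} (hf : ContDiff ℝ ∞ f)
    (hc : HasCompactSupport f) (hs : tsupport f ⊆ Ioi 0) :
    ∫ x in Ioi (0 : ℝ), deriv f x • ∫ t in Ioc 0 x, ψ t = -∫ x in Ioi (0 : ℝ), f x • ψ x := by
  obtain ⟨ε, R, -, hR⟩ := exists_Icc_of_test hc hs
  have hd : Continuous (deriv f) := hf.continuous_deriv (by simp)
  have hf0 : ∀ x, R < x → f x = 0 := fun x hx =>
    image_eq_zero_of_notMem_tsupport fun h => absurd (hR h).2 (not_le.mpr hx)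
  have hd0 : ∀ x, R < x → deriv f x = 0 := fun x hx =>
    image_eq_zero_of_notMem_tsupport fun h =>
      absurd (hR (closure_minimal support_deriv_subset (isClosed_tsupport f) h)).2
        (not_le.mpr hx)
  let F : ℝ → ℝ → ℂ := fun x t => deriv f x • (Iic x).indicator (fun t => ψ t) t
  have hF : Integrable (Function.uncurry F)
      ((volume.restrict (Ioi (0 : ℝ))).prod (volume.restrict (Ioc 0 R))) := by
    have h1 : Integrable (deriv f) (volume.restrict (Ioi (0 : ℝ))) :=
      (hd.integrable_of_hasCompactSupport hc.deriv).restrict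
    have h2 := h1.smul_prod (ψ.integrableOn_Ioc R)
    have hm : MeasurableSet {z : ℝ × ℝ | z.2 ≤ z.1} := measurableSet_le measurable_snd measurable_fst
    refine (h2.indicator hm).congr (Filter.Eventually.of_forall fun z => ?_)
    by_cases hz : z.2 ≤ z.1
    · simp [F, Function.uncurry, indicator, hz]
    · simp [F, Function.uncurry, indicator, hz]
  have hswap := integral_integral_swap hF
  have hl : ∫ x in Ioi (0 : ℝ), ∫ t in Ioc 0 R, F x t
      = ∫ x in Ioi (0 : ℝ), deriv f x • ∫ t in Ioc 0 x, ψ t := by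
    refine integral_congr_ae (Filter.Eventually.of_forall fun x => ?_)
    simp only [F]
    rw [integral_smul]
    rcases lt_or_ge R x with hx | hx
    · rw [hd0 x hx, zero_smul, zero_smul]
    · rw [setIntegral_indicator measurableSet_Iic]
      congr 3
      ext t
      simp only [mem_inter_iff, mem_Ioc, mem_Iic]
      constructor
      · exact fun h => ⟨h.1.1, h.2⟩
      · exact fun h => ⟨⟨h.1, h.2.trans hx⟩, h.2⟩
  have hr : ∫ t in Ioc 0 R, ∫ x in Ioi (0 : ℝ), F x t = ∫ t in Ioc 0 R, -(f t • ψ t) := by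
    refine setIntegral_congr_fun measurableSet_Ioc fun t ht => ?_
    have e : ∀ x, F x t = (Ici t).indicator (fun x => deriv f x • ψ t) x := by
      intro x
      by_cases hx : t ≤ x
      · simp [F, indicator, hx]
      · simp [F, indicator, hx]
    simp only [e]
    rw [setIntegral_indicator measurableSet_Ici,
      show Ioi (0 : ℝ) ∩ Ici t = Ici t from inter_eq_right.mpr fun x hx => ht.1.trans_le hx,
      integral_Ici_eq_integral_Ioi, integral_smul_const,
      hc.integral_Ioi_deriv_eq (hf.of_le (by simp)), neg_smul]
  rw [← hl, hswap, hr, integral_neg]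
  congr 1
  refine setIntegral_eq_of_subset_of_forall_sdiff_eq_zero measurableSet_Ioi
    (fun t ht => ht.1) ?_ |>.symm
  intro t ht
  rw [hf0 t (not_le.mp fun h => ht.2 ⟨ht.1, h⟩), zero_smul]

lemma exists_test_primitive {k : ℝ → ℝ} (hk : ContDiff ℝ ∞ k) (hc : HasCompactSupport k)
    (hs : tsupport k ⊆ Ioi 0) (h0 : ∫ x, k x = 0) :
    ∃ F : ℝ → ℝ, ContDiff ℝ ∞ F ∧ HasCompactSupport F ∧ tsupport F ⊆ Ioi 0 ∧ deriv F = k := by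
  obtain ⟨ε, R, hε, hR⟩ := exists_Icc_of_test hc hs
  have hk0 : ∀ x, x ∉ Icc ε R → k x = 0 := fun x hx =>
    image_eq_zero_of_notMem_tsupport fun h => hx (hR h)
  have hi : Integrable k := hk.continuous.integrable_of_hasCompactSupport hc
  let F : ℝ → ℝ := fun x => ∫ t in Iic x, k t
  have hF : ∀ x, HasDerivAt F (k x) x := by
    intro x
    have e : F = fun y => (∫ t in Iic (0 : ℝ), k t) + ∫ t in (0 : ℝ)..y, k t := by
      funext y
      rw [← intervalIntegral.integral_Iic_sub_Iic hi.integrableOn hi.integrableOn]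
      simp [F]
    rw [e]
    exact (intervalIntegral.integral_hasDerivAt_right hi.intervalIntegrable
      (hk.continuous.stronglyMeasurableAtFilter _ _) hk.continuous.continuousAt).const_add _
  have hd : deriv F = k := funext fun x => (hF x).deriv
  have hsupp : Function.support F ⊆ Icc ε R := by
    intro x hx
    by_contra hn
    apply hx
    rcases lt_or_ge x ε with h | h
    · refine setIntegral_eq_zero_of_forall_eq_zero fun t ht => hk0 t fun h' => ?_
      exact absurd (h'.1.trans ht) (not_le.mpr h)
    · have hxR : R < x := not_le.mp fun h' => hn ⟨h, h'⟩
      have := setIntegral_eq_integral_of_forall_compl_eq_zero (μ := volume) (s := Iic x) (f := k)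
        (fun t ht => hk0 t fun h' => ht (h'.2.trans hxR.le))
      simp only [F]
      rw [this, h0]
  have hts : tsupport F ⊆ Icc ε R := closure_minimal hsupp isClosed_Icc
  refine ⟨F, ?_, HasCompactSupport.of_support_subset_isCompact isCompact_Icc hsupp, ?_, hd⟩
  · rw [contDiff_infty_iff_deriv, hd]
    exact ⟨fun x => (hF x).differentiableAt, hk⟩
  · exact fun x hx => hε.trans_le (hts hx).1

/-- An element of `H1` is almost everywhere a constant plus a primitive of its derivative. -/
lemma HasWeakDeriv.exists_primitive {φ ψ : L2} (h : HasWeakDeriv φ ψ) :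
    ∃ a : ℂ, ∀ᵐ x, x ∈ Ioi (0 : ℝ) → φ x = a + ∫ t in Ioc 0 x, ψ t := by
  set u : ℝ → ℂ := fun x => φ x - ∫ t in Ioc 0 x, ψ t with hu
  have hul : LocallyIntegrable u (volume.restrict (Ioi (0 : ℝ))) :=
    φ.locallyIntegrable.sub (continuous_primitive ψ).locallyIntegrable
  have hint : ∀ f : ℝ → ℝ, Continuous f → HasCompactSupport f →
      Integrable (fun x => f x • u x) (volume.restrict (Ioi (0 : ℝ))) := fun f hf hc =>
    hul.integrable_smul_left_of_hasCompactSupport hf hc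
  have hu0 : ∀ f : ℝ → ℝ, ContDiff ℝ ∞ f → HasCompactSupport f → tsupport f ⊆ Ioi 0 →
      ∫ x in Ioi (0 : ℝ), deriv f x • u x = 0 := by
    intro f hf hc hs
    have hd : Continuous (deriv f) := hf.continuous_deriv (by simp)
    simp only [hu, smul_sub]
    rw [integral_sub (φ.integrable_smul hd hc.deriv)
      ((continuous_primitive ψ).locallyIntegrable.integrable_smul_left_of_hasCompactSupport
        hd hc.deriv), h f hf hc hs, integral_deriv_smul_primitive ψ hf hc hs, sub_self]
  let b : ContDiffBump (1 : ℝ) := ⟨1 / 4, 1 / 2, by norm_num, by norm_num⟩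
  let f₀ : ℝ → ℝ := b.normed volume
  have hf₀ : ContDiff ℝ ∞ f₀ := b.contDiff_normed
  have hc₀ : HasCompactSupport f₀ := b.hasCompactSupport_normed
  have hs₀ : tsupport f₀ ⊆ Ioi 0 := by
    intro x hx
    rw [b.tsupport_normed_eq, Metric.mem_closedBall, Real.dist_eq] at hx
    have hx' : |x - 1| ≤ 1 / 2 := hx
    have := (abs_le.mp hx').1
    rw [mem_Ioi]
    linarith
  have hi₀ : ∫ x, f₀ x = 1 := b.integral_normed
  set a : ℂ := ∫ x in Ioi (0 : ℝ), f₀ x • u x with ha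
  refine ⟨a, ?_⟩
  have key := ae_zero_of_test (u := fun x => u x - a) (hul.sub (locallyIntegrable_const a)) (by
    intro f hf hc hs
    set m : ℝ := ∫ x, f x with hm
    have hif : Integrable f := hf.continuous.integrable_of_hasCompactSupport hc
    have hif₀ : Integrable f₀ := hf₀.continuous.integrable_of_hasCompactSupport hc₀
    have hks : tsupport (fun x => f x - m * f₀ x) ⊆ tsupport f ∪ tsupport f₀ := by
      refine closure_minimal ?_ ((isClosed_tsupport f).union (isClosed_tsupport f₀))
      intro x hx
      by_contra hn
      rw [mem_union, not_or] at hn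
      apply hx
      simp only
      rw [image_eq_zero_of_notMem_tsupport hn.1, image_eq_zero_of_notMem_tsupport hn.2]
      simp
    obtain ⟨F, hF, hFc, hFs, hFd⟩ := exists_test_primitive
      (k := fun x => f x - m * f₀ x) (hf.sub (contDiff_const.mul hf₀))
      ((hc.isCompact.union hc₀.isCompact).of_isClosed_subset (isClosed_tsupport _) hks)
      (hks.trans (union_subset hs hs₀)) (by
        rw [integral_sub hif (hif₀.const_mul m), integral_const_mul, hi₀, mul_one, hm, sub_self])
    have h1 := hu0 F hF hFc hFs
    rw [hFd] at h1
    have h2 : ∫ x in Ioi (0 : ℝ), f x • u x = m • a := by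
      have e : ∀ x, (f x - m * f₀ x) • u x = f x • u x - m • (f₀ x • u x) := fun x => by
        rw [sub_smul, smul_smul]
      simp only [e] at h1
      have hi : Integrable (fun x => m • (f₀ x • u x)) (volume.restrict (Ioi (0 : ℝ))) :=
        (hint f₀ hf₀.continuous hc₀).smul m
      rw [integral_sub (hint f hf.continuous hc) hi, integral_smul] at h1
      exact sub_eq_zero.mp h1
    have h3 : ∫ x in Ioi (0 : ℝ), f x = m :=
      setIntegral_eq_integral_of_forall_compl_eq_zero fun x hx =>
        image_eq_zero_of_notMem_tsupport fun h' => hx (hs h')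
    simp only [smul_sub]
    rw [integral_sub (hint f hf.continuous hc) (hif.restrict.smul_const a), h2,
      integral_smul_const, h3, sub_self])
  filter_upwards [(ae_restrict_iff' measurableSet_Ioi).mp key] with x hx hx0
  have := hx hx0
  simp only [hu] at this
  linear_combination this

lemma HasWeakDeriv.exists_hasTrace {φ ψ : L2} (h : HasWeakDeriv φ ψ) : ∃ a, HasTrace φ a := by
  obtain ⟨a, ha⟩ := h.exists_primitive
  have hg : Continuous fun x : ℝ => a + ∫ t in Ioc 0 x, ψ t :=
    continuous_const.add (continuous_primitive ψ)
  exact ⟨_, _, hg.continuousOn, ha, (hg.tendsto 0).mono_left nhdsWithin_le_nhds⟩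

open Classical in
/-- The boundary value `φ(0+)` of an element of `H1` (and `0` if there is no boundary value). -/
def trace (φ : L2) : ℂ := if h : ∃ a, HasTrace φ a then h.choose else 0

lemma HasTrace.trace_eq {φ : L2} {a : ℂ} (h : HasTrace φ a) : trace φ = a := by
  have h' : ∃ a, HasTrace φ a := ⟨a, h⟩
  rw [trace, dif_pos h']
  exact h'.choose_spec.unique h

lemma hasTrace_trace {φ : L2} (h : φ ∈ H1) : HasTrace φ (trace φ) := by
  obtain ⟨ψ, hψ⟩ := h
  obtain ⟨a, ha⟩ := hψ.exists_hasTrace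
  rwa [ha.trace_eq]

lemma trace_add {φ₁ φ₂ : L2} (h₁ : φ₁ ∈ H1) (h₂ : φ₂ ∈ H1) :
    trace (φ₁ + φ₂) = trace φ₁ + trace φ₂ :=
  ((hasTrace_trace h₁).add (hasTrace_trace h₂)).trace_eq

lemma trace_smul (c : ℂ) {φ : L2} (h : φ ∈ H1) : trace (c • φ) = c * trace φ :=
  ((hasTrace_trace h).smul c).trace_eq

lemma trace_zero : trace 0 = 0 := hasTrace_zero.trace_eq

/-! ### The operator -/

/-- The Hilbert space direct sum `L² ⊕ 𝔥`. -/
abbrev Space (𝔥 : Type*) [NormedAddCommGroup 𝔥] [InnerProductSpace ℂ 𝔥] : Type _ :=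
  WithLp 2 (L2 × 𝔥)

section Operator

variable {𝔥 : Type*} [NormedAddCommGroup 𝔥] [InnerProductSpace ℂ 𝔥]

/-- The operator `A (φ, y) = (φ'', L y + φ'(0+) w)`, with domain the pairs `(φ, y)`
in `H² ⊕ 𝔥` such that `θ φ'(0+) + φ(0+) = ⟨w, y⟩`. -/
def lambOperator (L : 𝔥 →ₗ[ℂ] 𝔥) (w : 𝔥) (θ : ℝ) : Space 𝔥 →ₗ.[ℂ] Space 𝔥 where
  domain :=
    { carrier := {Ψ | Ψ.fst ∈ H2 ∧
        (θ : ℂ) * trace (weakDeriv Ψ.fst) + trace Ψ.fst = inner ℂ w Ψ.snd}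
      zero_mem' := by
        refine ⟨H2.zero_mem, ?_⟩
        simp [weakDeriv_zero, trace_zero]
      add_mem' := by
        rintro Ψ Φ ⟨h₁, e₁⟩ ⟨h₂, e₂⟩
        refine ⟨H2.add_mem h₁ h₂, ?_⟩
        rw [WithLp.add_fst, WithLp.add_snd, weakDeriv_add h₁.1 h₂.1, trace_add h₁.2 h₂.2,
          trace_add h₁.1 h₂.1, inner_add_right, ← e₁, ← e₂]
        ring
      smul_mem' := by
        rintro c Ψ ⟨h, e⟩
        refine ⟨H2.smul_mem c h, ?_⟩
        rw [WithLp.smul_fst, WithLp.smul_snd, weakDeriv_smul c h.1, trace_smul c h.2,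
          trace_smul c h.1, inner_smul_right, ← e]
        ring }
  toFun :=
    { toFun := fun Ψ => WithLp.toLp 2 (weakDeriv (weakDeriv Ψ.1.fst),
        L Ψ.1.snd + trace (weakDeriv Ψ.1.fst) • w)
      map_add' := by
        rintro ⟨Ψ, h₁, e₁⟩ ⟨Φ, h₂, e₂⟩
        rw [← WithLp.toLp_add, Prod.mk_add_mk]
        simp only [Submodule.coe_add, WithLp.add_fst, WithLp.add_snd]
        rw [weakDeriv_add h₁.1 h₂.1, weakDeriv_add h₁.2 h₂.2, trace_add h₁.2 h₂.2, map_add,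
          add_smul, add_add_add_comm]
      map_smul' := by
        rintro c ⟨Ψ, h, e⟩
        rw [RingHom.id_apply, ← WithLp.toLp_smul, Prod.smul_mk]
        simp only [Submodule.coe_smul, WithLp.smul_fst, WithLp.smul_snd]
        rw [weakDeriv_smul c h.1, weakDeriv_smul c h.2, trace_smul c h.2, map_smul,
          smul_add, smul_smul] }

end Operator

/-! ### The closed quadratic form of an operator -/

section Form

variable {H : Type*} [NormedAddCommGroup H] [InnerProductSpace ℂ H]

/-- `q` is a value at `x` of the closure of the quadratic form `u ↦ ⟨u, T u⟩` on the domain of the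
symmetric operator `T`: there are `u n` in the domain of `T` which converge to `x` and are Cauchy
with respect to the form, and `⟨u n, T (u n)⟩` converges to `q`. -/
def IsFormValue (T : H →ₗ.[ℂ] H) (x : H) (q : ℝ) : Prop :=
  ∃ u : ℕ → T.domain,
    Tendsto (fun n => (u n : H)) atTop (𝓝 x) ∧
    Tendsto (fun p : ℕ × ℕ =>
      (inner ℂ ((u p.1 - u p.2 : T.domain) : H) (T (u p.1 - u p.2))).re) atTop (𝓝 0) ∧
    Tendsto (fun n => (inner ℂ (u n : H) (T (u n))).re) atTop (𝓝 q)

/-- The domain of the closed quadratic form of `T`. -/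
def formDomain (T : H →ₗ.[ℂ] H) : Set H := {x | ∃ q, IsFormValue T x q}

open Classical in
/-- The closed quadratic form of `T` (and `0` outside of its domain). -/
def quadForm (T : H →ₗ.[ℂ] H) (x : H) : ℝ := if h : ∃ q, IsFormValue T x q then h.choose else 0

/-- A quadratic form `q` with domain `D` is closed: whenever a sequence in `D` converges in the
Hilbert space and is Cauchy with respect to `q`, the limit is in `D` and the sequence converges to
it with respect to `q`. -/
def IsClosedForm (D : Set H) (q : H → ℝ) : Prop :=
  ∀ (u : ℕ → H) (x : H), (∀ n, u n ∈ D) → Tendsto u atTop (𝓝 x) →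
    Tendsto (fun p : ℕ × ℕ => q (u p.1 - u p.2)) atTop (𝓝 0) →
    x ∈ D ∧ Tendsto (fun n => q (u n - x)) atTop (𝓝 0)

end Form

end Lamb

end

/-!
The idea is to find the form first and to recover the operator from it. On the triples
`(φ', (φ, y))` with `φ ∈ H¹`, subject to `φ(0+) = ⟨w, y⟩` only if `θ = 0`, consider the Hermitian form
`⟨φ₁', φ₂'⟩ - ⟨y₁, L y₂⟩ - θ⁻¹ conj (φ₁(0+) - ⟨w, y₁⟩) (φ₂(0+) - ⟨w, y₂⟩)`, where `θ⁻¹` is read as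
`0` for `θ = 0`. These triples form a closed subspace `FormSpace w θ` of a Hilbert space.
Integration by parts on the half line (`HasWeakDeriv.inner_add_inner`) gives the trace inequality
`|φ(0+)|² ≤ 2 ‖φ‖ ‖φ'‖`, which makes the form bounded, and coercive after a multiple of the norm
of `L² ⊕ 𝔥` has been added (`exists_coerciveBound`).

The operator associated with this form is `-A` (`isFormOperator_neg_lambOperator`). In one
direction this is integration by parts. In the other, a triple on which the form is represented by
a vector is tested against functions supported away from `0`, which gives `φ'' ∈ L²`, and then
against functions with prescribed boundary value, which gives the second component of `A` and, for
`θ ≠ 0`, the boundary condition `θ φ'(0+) + φ(0+) = ⟨w, y⟩`.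

The rest holds for the operator `T` of any closed form `b` bounded below (`IsFormOperator`). By
Lax–Milgram `T + c` is surjective for large `c`. With coercivity this shows that the domain of `T`
is dense, and with symmetry that `T` is self-adjoint. It also shows that the operator domain is
dense in the form domain (`IsFormOperator.dense_lift`): if `g` is orthogonal to it, the weak
solution `k` of `(b + c) k = g`, seen as a vector of the ambient space, is orthogonal to the range
of `T + c`, hence zero. Sequences that are Cauchy for the form and converge in the ambient space
are Cauchy in the form domain, so that the closure of the form of `T` is the given form
(`IsFormOperator.isFormValue_iff`), and it is closed because the form domain is complete.
-/

namespace Lamb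

/-! ### The operator of a closed form bounded below -/

section Abstract

variable {V H : Type*} [NormedAddCommGroup V] [InnerProductSpace ℂ V]
  [NormedAddCommGroup H] [InnerProductSpace ℂ H]

/-- Lax–Milgram over `ℂ`. -/
lemma surjective_of_coercive [CompleteSpace V] (S : V →L[ℂ] V) {δ : ℝ} (hδ : 0 < δ)
    (hS : ∀ v, δ * ‖v‖ ^ 2 ≤ (inner ℂ v (S v)).re) : Function.Surjective S := by
  have hb : ∀ v, ‖v‖ ≤ δ⁻¹ * ‖S v‖ := by
    intro v
    rcases eq_or_ne v 0 with rfl | hv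
    · simp
    have h1 : δ * ‖v‖ ^ 2 ≤ ‖v‖ * ‖S v‖ :=
      (hS v).trans ((Complex.re_le_norm _).trans (norm_inner_le_norm _ _))
    have hv' : 0 < ‖v‖ := norm_pos_iff.mpr hv
    rw [le_inv_mul_iff₀ hδ]
    nlinarith
  have ha : AntilipschitzWith (δ⁻¹).toNNReal S := by
    refine ContinuousLinearMap.antilipschitz_of_bound S fun v => ?_
    rw [Real.coe_toNNReal _ (inv_pos.mpr hδ).le]
    exact hb v
  have hc : IsClosed (S.range : Set V) := ha.isClosed_range S.uniformContinuous
  have := hc.completeSpace_coe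
  rw [← ContinuousLinearMap.coe_coe, ← LinearMap.range_eq_top,
    ← Submodule.orthogonal_eq_bot_iff, Submodule.eq_bot_iff]
  intro v hv
  have h0 : inner ℂ v (S v) = 0 := (Submodule.mem_orthogonal' _ _).mp hv _ ⟨v, rfl⟩
  have h1 := hS v
  rw [h0, Complex.zero_re] at h1
  have : ‖v‖ ^ 2 = 0 := le_antisymm (by nlinarith) (by positivity)
  simpa using this

/-- A symmetric operator `A` such that `A + c` is surjective for some real `c` is self-adjoint. -/
lemma isSelfAdjoint_of_surjective [CompleteSpace H] {A : H →ₗ.[ℂ] H}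
    (hd : Dense (A.domain : Set H)) (hA : A.IsFormalAdjoint A) (c : ℝ)
    (hs : ∀ F : H, ∃ x : A.domain, A x + (c : ℂ) • (x : H) = F) : IsSelfAdjoint A := by
  rw [LinearPMap.isSelfAdjoint_def]
  have hle : A ≤ A.adjoint := hA.le_adjoint hd
  symm
  refine LinearPMap.eq_of_le_of_domain_eq hle (le_antisymm hle.1 fun y hy => ?_)
  obtain ⟨x, hx⟩ := hs (A.adjoint ⟨y, hy⟩ + (c : ℂ) • y)
  have h0 : ∀ z : A.domain, inner ℂ (y - (x : H)) (A z + (c : ℂ) • (z : H)) = 0 := by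
    intro z
    have h1 : inner ℂ (A.adjoint ⟨y, hy⟩) (z : H) = inner ℂ y (A z) :=
      A.adjoint_isFormalAdjoint hd ⟨y, hy⟩ z
    have h2 : inner ℂ (A x) (z : H) = inner ℂ (x : H) (A z) := hA x z
    have h3 := congrArg (fun t => inner ℂ t (z : H)) hx
    simp only [inner_add_left, inner_smul_left, Complex.conj_ofReal, h1, h2] at h3
    rw [inner_sub_left, inner_add_right, inner_add_right, inner_smul_right, inner_smul_right]
    linear_combination -h3
  -- `y - x` is orthogonal to the range of `A + c`, which is everything.
  obtain ⟨z, hz⟩ := hs (y - x)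
  have h1 := h0 z
  rw [hz, inner_self_eq_zero, sub_eq_zero] at h1
  rw [h1]
  exact x.2

/-- `T` is the operator associated with the form `(u, v) ↦ ⟨u, B v⟩` whose domain is the Hilbert
space `V`, embedded into `H` by `P`: one has `T x = F` if and only if `x = P v` for some `v` with
`⟨u, B v⟩ = ⟨P u, F⟩` for all `u`. -/
def IsFormOperator (P : V →L[ℂ] H) (B : V →L[ℂ] V) (T : H →ₗ.[ℂ] H) : Prop :=
  ∀ x F : H, (x, F) ∈ T.graph ↔ ∃ v, P v = x ∧ ∀ u, inner ℂ u (B v) = inner ℂ (P u) F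

namespace IsFormOperator

variable {P : V →L[ℂ] H} {B : V →L[ℂ] V} {T : H →ₗ.[ℂ] H}

lemma exists_lift (hT : IsFormOperator P B T) (x : T.domain) :
    ∃ v, P v = x ∧ ∀ u, inner ℂ u (B v) = inner ℂ (P u) (T x) :=
  (hT _ _).mp (T.mem_graph x)

lemma exists_domain (hT : IsFormOperator P B T) {v : V} {F : H}
    (h : ∀ u, inner ℂ u (B v) = inner ℂ (P u) F) : ∃ x : T.domain, (x : H) = P v ∧ T x = F :=
  T.mem_graph_iff.mp ((hT (P v) F).mpr ⟨v, rfl, h⟩)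

lemma isFormalAdjoint (hT : IsFormOperator P B T) (hB : (B : V →ₗ[ℂ] V).IsSymmetric) :
    T.IsFormalAdjoint T := by
  intro x y
  obtain ⟨v, hv, hv'⟩ := hT.exists_lift x
  obtain ⟨u, hu, hu'⟩ := hT.exists_lift y
  have hs : inner ℂ (B v) u = inner ℂ v (B u) := hB v u
  rw [← hv, ← hu', ← hu, ← hs, ← inner_conj_symm, ← inner_conj_symm (B v), hv']

/-- The form `v ↦ ⟨v, B v⟩ + c ‖P v‖²` is coercive on `V`, with constant `δ`. -/
def CoerciveBound (P : V →L[ℂ] H) (B : V →L[ℂ] V) (δ c : ℝ) : Prop :=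
  ∀ v, δ * ‖v‖ ^ 2 ≤ (inner ℂ v (B v)).re + c * ‖P v‖ ^ 2

variable {δ c : ℝ}

lemma eq_zero_of_form_eq_zero (hδ : 0 < δ) (hc : CoerciveBound P B δ c) {v : V}
    (h : inner ℂ v (B v) + c * inner ℂ (P v) (P v) = 0) : v = 0 := by
  have h1 := hc v
  have h2 := congrArg Complex.re h
  have h3 : (inner ℂ (P v) (P v)).re = ‖P v‖ ^ 2 := inner_self_eq_norm_sq (𝕜 := ℂ) _
  rw [Complex.add_re, Complex.re_ofReal_mul, h3, Complex.zero_re] at h2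
  rw [h2] at h1
  have : ‖v‖ ^ 2 = 0 := le_antisymm (by simpa using nonpos_of_mul_nonpos_right h1 hδ)
    (by positivity)
  simpa using this

lemma bounded_below (hT : IsFormOperator P B T) (hδ : 0 < δ) (hc : CoerciveBound P B δ c)
    (x : T.domain) : -c * ‖(x : H)‖ ^ 2 ≤ (inner ℂ (x : H) (T x)).re := by
  obtain ⟨v, hv, hv'⟩ := hT.exists_lift x
  rw [← hv, ← hv']
  have := hc v
  have : 0 ≤ δ * ‖v‖ ^ 2 := by positivity
  linarith

section Complete

variable [CompleteSpace V] [CompleteSpace H]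

lemma exists_weak_solution (hδ : 0 < δ) (hc : CoerciveBound P B δ c) (g : V) :
    ∃ v, ∀ u, inner ℂ u (B v) + c * inner ℂ (P u) (P v) = inner ℂ u g := by
  obtain ⟨v, hv⟩ := surjective_of_coercive (B + (c : ℂ) • (P.adjoint ∘L P)) hδ (fun v => by
    refine (hc v).trans_eq ?_
    simp only [add_apply, smul_apply,
      ContinuousLinearMap.comp_apply, inner_add_right, inner_smul_right,
      ContinuousLinearMap.adjoint_inner_right, Complex.add_re, Complex.re_ofReal_mul]
    rw [inner_self_eq_norm_sq_to_K]
    norm_cast) g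
  refine ⟨v, fun u => ?_⟩
  rw [← hv]
  simp only [add_apply, smul_apply,
    ContinuousLinearMap.comp_apply, inner_add_right, inner_smul_right,
    ContinuousLinearMap.adjoint_inner_right]

lemma exists_resolvent (hT : IsFormOperator P B T) (hδ : 0 < δ) (hc : CoerciveBound P B δ c)
    (F : H) : ∃ (x : T.domain) (v : V), P v = x ∧ T x + (c : ℂ) • (x : H) = F ∧
      ∀ u, inner ℂ u (B v) + c * inner ℂ (P u) (P v) = inner ℂ (P u) F := by
  obtain ⟨v, hv⟩ := exists_weak_solution hδ hc (P.adjoint F)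
  simp only [ContinuousLinearMap.adjoint_inner_right] at hv
  obtain ⟨x, hx, hx'⟩ := hT.exists_domain (v := v) (F := F - (c : ℂ) • P v) (fun u => by
    rw [inner_sub_right, inner_smul_right, ← hv]
    ring)
  exact ⟨x, v, hx.symm, by rw [hx', hx, sub_add_cancel], hv⟩

/-- The domain is dense: a vector `F` orthogonal to it is orthogonal to `(T + c)⁻¹ F`, and this
forces `(T + c)⁻¹ F = 0`. -/
lemma dense_domain (hT : IsFormOperator P B T) (hδ : 0 < δ) (hc : CoerciveBound P B δ c) :
    Dense (T.domain : Set H) := by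
  rw [Submodule.dense_iff_topologicalClosure_eq_top,
    Submodule.topologicalClosure_eq_top_iff, Submodule.eq_bot_iff]
  intro F hF
  obtain ⟨x, v, hv, hx, hu⟩ := hT.exists_resolvent hδ hc F
  have h0 : v = 0 := eq_zero_of_form_eq_zero hδ hc (by
    rw [hu v, hv]
    exact (Submodule.mem_orthogonal _ _).mp hF _ x.2)
  have hx0 : x = 0 := Subtype.ext (by rw [← hv, h0, map_zero]; rfl)
  rw [← hx, hx0]
  simp

lemma isSelfAdjoint_neg (hT : IsFormOperator P B (-T)) (hB : (B : V →ₗ[ℂ] V).IsSymmetric)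
    (hδ : 0 < δ) (hc : CoerciveBound P B δ c) : IsSelfAdjoint T := by
  refine isSelfAdjoint_of_surjective (hT.dense_domain hδ hc) ?_ (-c) fun F => ?_
  · intro x y
    have h : inner ℂ (-(T x)) (y : H) = inner ℂ (x : H) (-(T y)) := hT.isFormalAdjoint hB x y
    rwa [inner_neg_left, inner_neg_right, neg_inj] at h
  · obtain ⟨x, v, hv, hx, hu⟩ := hT.exists_resolvent hδ hc (-F)
    refine ⟨x, ?_⟩
    have h : -(T x) + (c : ℂ) • (x : H) = -F := hx
    rw [← neg_neg F, ← h]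
    simp [add_comm]

/-- The lifts of the operator domain are dense in the form domain, that is, the operator domain is
a form core. -/
lemma dense_lift (hT : IsFormOperator P B T) (hB : (B : V →ₗ[ℂ] V).IsSymmetric)
    (hP : Function.Injective P) (hδ : 0 < δ) (hc : CoerciveBound P B δ c) :
    Dense {v : V | ∃ F, ∀ u, inner ℂ u (B v) = inner ℂ (P u) F} := by
  let D : Submodule ℂ V :=
    { carrier := {v : V | ∃ F, ∀ u, inner ℂ u (B v) = inner ℂ (P u) F}
      zero_mem' := ⟨0, by simp⟩
      add_mem' := fun ⟨F, hF⟩ ⟨G, hG⟩ => ⟨F + G, fun u => by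
        rw [map_add, inner_add_right, inner_add_right, hF, hG]⟩
      smul_mem' := fun a _ ⟨F, hF⟩ => ⟨a • F, fun u => by
        rw [map_smul, inner_smul_right, inner_smul_right, hF]⟩ }
  change Dense (D : Set V)
  rw [Submodule.dense_iff_topologicalClosure_eq_top,
    Submodule.topologicalClosure_eq_top_iff, Submodule.eq_bot_iff]
  intro g hg
  -- `g = (b + c) k` in the weak sense. With `v = (T + c)⁻¹ (P k)`, orthogonality of `v` and `g`
  -- says that `⟨P k, P k⟩ = 0`.
  obtain ⟨k, hk⟩ := exists_weak_solution hδ hc g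
  obtain ⟨x, v, hv, hx, hu⟩ := hT.exists_resolvent hδ hc (P k)
  have hvD : v ∈ D := ⟨P k - (c : ℂ) • P v, fun u => by
    rw [inner_sub_right, inner_smul_right, ← hu]; ring⟩
  have h1 : inner ℂ v g = 0 := (Submodule.mem_orthogonal _ _).mp hg v hvD
  have hs : inner ℂ (B v) k = inner ℂ v (B k) := hB v k
  have h2 : inner ℂ (P k) (P k) = 0 := by
    rw [← hu k, ← inner_conj_symm, hs, ← inner_conj_symm (P k), ← map_zero (starRingEnd ℂ), ← h1,
      ← hk v, map_add, map_mul, Complex.conj_ofReal]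
  have hk0 : k = 0 := hP (by rw [inner_self_eq_zero.mp h2, map_zero])
  have h3 := hk g
  rw [hk0] at h3
  simpa using h3.symm

lemma exists_seq_lift (hT : IsFormOperator P B T) (hB : (B : V →ₗ[ℂ] V).IsSymmetric)
    (hP : Function.Injective P) (hδ : 0 < δ) (hc : CoerciveBound P B δ c) (v : V) :
    ∃ (k : ℕ → V) (x : ℕ → T.domain), Tendsto k atTop (𝓝 v) ∧ (∀ n, P (k n) = x n) ∧
      ∀ n u, inner ℂ u (B (k n)) = inner ℂ (P u) (T (x n)) := by
  obtain ⟨k, hk, hkv⟩ := mem_closure_iff_seq_limit.mp (hT.dense_lift hB hP hδ hc v)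
  choose F hF using hk
  choose x hx hx' using fun n => hT.exists_domain (hF n)
  exact ⟨k, x, hkv, fun n => (hx n).symm, fun n u => by rw [hx' n]; exact hF n u⟩

end Complete

/-- A sequence that is Cauchy with respect to the form and converges in `H` is Cauchy in the form
domain. -/
lemma cauchySeq_of_form (hδ : 0 < δ) (hc : CoerciveBound P B δ c) {v : ℕ → V} {x : H}
    (hx : Tendsto (fun n => P (v n)) atTop (𝓝 x))
    (hv : Tendsto (fun p : ℕ × ℕ => (inner ℂ (v p.1 - v p.2) (B (v p.1 - v p.2))).re)
      atTop (𝓝 0)) : CauchySeq v := by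
  have h1 : Tendsto (fun p : ℕ × ℕ => ‖P (v p.1 - v p.2)‖ ^ 2) atTop (𝓝 0) := by
    have h : Tendsto (fun p : ℕ × ℕ => P (v p.1) - P (v p.2)) atTop (𝓝 (x - x)) := by
      rw [← prod_atTop_atTop_eq]
      exact (hx.comp tendsto_fst).sub (hx.comp tendsto_snd)
    simpa using (h.norm.pow 2)
  have h2 : Tendsto (fun p : ℕ × ℕ => ‖v p.1 - v p.2‖ ^ 2) atTop (𝓝 0) := by
    have h := ((hv.add (h1.const_mul c)).const_mul δ⁻¹)
    simp only [mul_zero, add_zero] at h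
    refine squeeze_zero (fun p => by positivity) (fun p => ?_) h
    rw [le_inv_mul_iff₀ hδ]
    exact hc _
  have h3 : Tendsto (fun p : ℕ × ℕ => ‖v p.1 - v p.2‖) atTop (𝓝 0) := by
    have h := (Real.continuous_sqrt.tendsto 0).comp h2
    simpa [Function.comp_def] using h
  rw [cauchySeq_iff_tendsto_dist_atTop_0]
  simpa only [dist_eq_norm] using h3

lemma continuous_form (B : V →L[ℂ] V) : Continuous fun v => (inner ℂ v (B v)).re :=
  Complex.continuous_re.comp (continuous_id.inner B.continuous)

section Complete

variable [CompleteSpace V] [CompleteSpace H]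

/-- The closure of the form of `T` is the form `v ↦ ⟨v, B v⟩` on the space `V`. -/
lemma isFormValue_iff (hT : IsFormOperator P B T) (hB : (B : V →ₗ[ℂ] V).IsSymmetric)
    (hP : Function.Injective P) (hδ : 0 < δ) (hc : CoerciveBound P B δ c) {x : H} {q : ℝ} :
    IsFormValue T x q ↔ ∃ v, P v = x ∧ q = (inner ℂ v (B v)).re := by
  constructor
  · rintro ⟨u, hux, huc, huq⟩
    choose k hk hk' using fun n => hT.exists_lift (u n)
    have hform : ∀ n m, inner ℂ (k n - k m) (B (k n - k m)) =
        inner ℂ ((u n - u m : T.domain) : H) (T (u n - u m)) := by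
      intro n m
      rw [map_sub B, inner_sub_right, hk' n, hk' m, ← inner_sub_right, map_sub P, hk, hk,
        LinearPMap.map_sub]
      rfl
    obtain ⟨v, hv⟩ := cauchySeq_tendsto_of_complete
      (cauchySeq_of_form hδ hc (v := k) (x := x) (by simpa only [hk] using hux)
        (by simpa only [hform] using huc))
    refine ⟨v, tendsto_nhds_unique ((P.continuous.tendsto v).comp hv) ?_,
      tendsto_nhds_unique huq ?_⟩
    · simpa only [Function.comp_def, hk] using hux
    · have h := ((continuous_form B).tendsto v).comp hv
      simpa only [Function.comp_def, hk', hk] using h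
  · rintro ⟨v, rfl, rfl⟩
    obtain ⟨k, u, hkv, hku, hkB⟩ := hT.exists_seq_lift hB hP hδ hc v
    have hform : ∀ n m, inner ℂ (k n - k m) (B (k n - k m)) =
        inner ℂ ((u n - u m : T.domain) : H) (T (u n - u m)) := by
      intro n m
      rw [map_sub B, inner_sub_right, hkB n, hkB m, ← inner_sub_right, map_sub P, hku, hku,
        LinearPMap.map_sub]
      rfl
    refine ⟨u, ?_, ?_, ?_⟩
    · simpa only [Function.comp_def, hku] using (P.continuous.tendsto v).comp hkv
    · have h : Tendsto (fun p : ℕ × ℕ => k p.1 - k p.2) atTop (𝓝 (v - v)) := by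
        rw [← prod_atTop_atTop_eq]
        exact (hkv.comp tendsto_fst).sub (hkv.comp tendsto_snd)
      have h' := ((continuous_form B).tendsto _).comp h
      simpa only [Function.comp_def, hform, sub_self, inner_zero_left, Complex.zero_re] using h'
    · have h := ((continuous_form B).tendsto v).comp hkv
      simpa only [Function.comp_def, hkB, hku] using h

lemma formDomain_eq (hT : IsFormOperator P B T) (hB : (B : V →ₗ[ℂ] V).IsSymmetric)
    (hP : Function.Injective P) (hδ : 0 < δ) (hc : CoerciveBound P B δ c) :
    formDomain T = range P := by
  ext x
  simp only [formDomain, mem_ofPred_eq, hT.isFormValue_iff hB hP hδ hc, mem_range]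
  exact ⟨fun ⟨_, v, hv, _⟩ => ⟨v, hv⟩, fun ⟨v, hv⟩ => ⟨_, v, hv, rfl⟩⟩

lemma eq_quadForm (hT : IsFormOperator P B T) (hB : (B : V →ₗ[ℂ] V).IsSymmetric)
    (hP : Function.Injective P) (hδ : 0 < δ) (hc : CoerciveBound P B δ c) {x : H} {q : ℝ}
    (hq : IsFormValue T x q) : q = quadForm T x := by
  have h : ∃ q, IsFormValue T x q := ⟨q, hq⟩
  rw [quadForm, dif_pos h]
  obtain ⟨v, hv, rfl⟩ := (hT.isFormValue_iff hB hP hδ hc).mp hq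
  obtain ⟨u, hu, e⟩ := (hT.isFormValue_iff hB hP hδ hc).mp h.choose_spec
  rw [e, hP (hu.trans hv.symm)]

lemma quadForm_apply (hT : IsFormOperator P B T) (hB : (B : V →ₗ[ℂ] V).IsSymmetric)
    (hP : Function.Injective P) (hδ : 0 < δ) (hc : CoerciveBound P B δ c) (v : V) :
    quadForm T (P v) = (inner ℂ v (B v)).re :=
  (hT.eq_quadForm hB hP hδ hc ((hT.isFormValue_iff hB hP hδ hc).mpr ⟨v, rfl, rfl⟩)).symm

lemma isClosedForm (hT : IsFormOperator P B T) (hB : (B : V →ₗ[ℂ] V).IsSymmetric)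
    (hP : Function.Injective P) (hδ : 0 < δ) (hc : CoerciveBound P B δ c) :
    IsClosedForm (formDomain T) (quadForm T) := by
  intro u x hu hux huc
  rw [hT.formDomain_eq hB hP hδ hc] at hu ⊢
  choose k hk using hu
  obtain rfl : (fun n => P (k n)) = u := funext hk
  simp only [← map_sub, hT.quadForm_apply hB hP hδ hc] at huc
  obtain ⟨v, hv⟩ := cauchySeq_tendsto_of_complete (cauchySeq_of_form hδ hc hux huc)
  have hvx : P v = x := tendsto_nhds_unique ((P.continuous.tendsto v).comp hv) hux
  refine ⟨⟨v, hvx⟩, ?_⟩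
  simp only [← hvx, ← map_sub, hT.quadForm_apply hB hP hδ hc]
  have h := ((continuous_form B).tendsto _).comp (hv.sub_const v)
  simpa only [Function.comp_def, sub_self, inner_zero_left, Complex.zero_re] using h

end Complete

end IsFormOperator

end Abstract

/-! ### Integration by parts on the half line -/

/-- Integration by parts for primitives of integrable functions, by Fubini's theorem: the square
`(0, R]²` is the union of its two triangles. -/
lemma integral_mul_primitive_add {u v : ℝ → ℂ} {R : ℝ} (hu : IntegrableOn u (Ioc 0 R))
    (hv : IntegrableOn v (Ioc 0 R)) :
    (∫ x in Ioc 0 R, u x * ∫ t in Ioc 0 x, v t) + ∫ x in Ioc 0 R, (∫ t in Ioc 0 x, u t) * v x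
      = (∫ x in Ioc 0 R, u x) * ∫ x in Ioc 0 R, v x := by
  have hF : Integrable (fun z : ℝ × ℝ => u z.1 * v z.2)
      ((volume.restrict (Ioc 0 R)).prod (volume.restrict (Ioc 0 R))) := Integrable.mul_prod hu hv
  have hm : MeasurableSet {z : ℝ × ℝ | z.2 ≤ z.1} := measurableSet_le measurable_snd measurable_fst
  have hsplit := integral_add_compl hm hF
  -- The lower triangle is integrated over `t` first, the upper one over `x` first.
  rw [← integral_indicator hm, ← integral_indicator hm.compl,
    integral_prod _ (hF.indicator hm), integral_prod_symm _ (hF.indicator hm.compl),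
    integral_prod_mul] at hsplit
  rw [← hsplit]
  congr 1
  · refine setIntegral_congr_fun measurableSet_Ioc fun x hx => ?_
    rw [← integral_const_mul, ← inter_eq_left.mpr (Ioc_subset_Ioc_right hx.2), inter_comm,
      show Ioc 0 R ∩ Ioc 0 x = Ioc 0 R ∩ Iic x by ext t; simp +contextual [and_assoc],
      ← setIntegral_indicator measurableSet_Iic]
    refine integral_congr_ae (Eventually.of_forall fun t => ?_)
    by_cases h : t ≤ x <;> simp [indicator, h]
  · refine setIntegral_congr_fun measurableSet_Ioc fun x hx => ?_
    rw [integral_Ioc_eq_integral_Ioo, ← integral_mul_const,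
      show Ioo 0 x = Ioc 0 R ∩ Iio x by
        ext t
        simp only [mem_Ioo, mem_inter_iff, mem_Ioc, mem_Iio]
        exact ⟨fun h => ⟨⟨h.1, h.2.le.trans hx.2⟩, h.2⟩, fun h => ⟨h.1.1, h.2⟩⟩,
      ← setIntegral_indicator measurableSet_Iio]
    refine integral_congr_ae (Eventually.of_forall fun t => ?_)
    by_cases h : t < x <;> simp [indicator, h]

lemma HasWeakDeriv.ae_eq_trace_add {φ ψ : L2} (h : HasWeakDeriv φ ψ) :
    ∀ᵐ x, x ∈ Ioi (0 : ℝ) → φ x = trace φ + ∫ t in Ioc 0 x, ψ t := by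
  obtain ⟨a, ha⟩ := h.exists_primitive
  have hg : Continuous fun x : ℝ => a + ∫ t in Ioc 0 x, ψ t :=
    continuous_const.add (continuous_primitive ψ)
  have ht : HasTrace φ (a + ∫ t in Ioc 0 (0 : ℝ), ψ t) :=
    ⟨_, hg.continuousOn, ha, (hg.tendsto 0).mono_left nhdsWithin_le_nhds⟩
  rw [Ioc_self, setIntegral_empty, add_zero] at ht
  rwa [ht.trace_eq]

/-- Integration by parts in `H¹`. -/
lemma HasWeakDeriv.inner_add_inner {φ₁ φ₂ ψ₁ ψ₂ : L2} (h₁ : HasWeakDeriv φ₁ ψ₁)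
    (h₂ : HasWeakDeriv φ₂ ψ₂) :
    inner ℂ ψ₁ φ₂ + inner ℂ φ₁ ψ₂ = -(starRingEnd ℂ (trace φ₁) * trace φ₂) := by
  set g₁ : ℝ → ℂ := fun x => trace φ₁ + ∫ t in Ioc 0 x, ψ₁ t with hg₁
  set g₂ : ℝ → ℂ := fun x => trace φ₂ + ∫ t in Ioc 0 x, ψ₂ t with hg₂
  have e₁ := (ae_restrict_iff' measurableSet_Ioi).mpr h₁.ae_eq_trace_add
  have e₂ := (ae_restrict_iff' measurableSet_Ioi).mpr h₂.ae_eq_trace_add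
  have c₁ : Continuous g₁ := continuous_const.add (continuous_primitive ψ₁)
  have c₂ : Continuous g₂ := continuous_const.add (continuous_primitive ψ₂)
  have i₁ : IntegrableOn (fun x => starRingEnd ℂ (ψ₁ x) * g₂ x) (Ioi 0) := by
    refine (L2.integrable_inner (𝕜 := ℂ) ψ₁ φ₂).congr ?_
    filter_upwards [e₂] with x hx
    rw [RCLike.inner_apply', hx]
  have i₂ : IntegrableOn (fun x => starRingEnd ℂ (g₁ x) * ψ₂ x) (Ioi 0) := by
    refine (L2.integrable_inner (𝕜 := ℂ) φ₁ ψ₂).congr ?_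
    filter_upwards [e₁] with x hx
    rw [RCLike.inner_apply', hx]
  have i₃ : IntegrableOn (fun x => starRingEnd ℂ (g₁ x) * g₂ x) (Ioi 0) := by
    refine (L2.integrable_inner (𝕜 := ℂ) φ₁ φ₂).congr ?_
    filter_upwards [e₁, e₂] with x hx hx'
    rw [RCLike.inner_apply', hx, hx']
  have hl : inner ℂ ψ₁ φ₂ + inner ℂ φ₁ ψ₂
      = ∫ x in Ioi 0, (starRingEnd ℂ (ψ₁ x) * g₂ x + starRingEnd ℂ (g₁ x) * ψ₂ x) := by
    rw [integral_add i₁ i₂, L2.inner_def, L2.inner_def]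
    congr 1
    · refine integral_congr_ae ?_
      filter_upwards [e₂] with x hx
      rw [RCLike.inner_apply', hx]
    · refine integral_congr_ae ?_
      filter_upwards [e₁] with x hx
      rw [RCLike.inner_apply', hx]
  have hR : ∀ R : ℝ, 0 ≤ R →
      ∫ x in (0 : ℝ)..R, (starRingEnd ℂ (ψ₁ x) * g₂ x + starRingEnd ℂ (g₁ x) * ψ₂ x)
        = starRingEnd ℂ (g₁ R) * g₂ R - starRingEnd ℂ (trace φ₁) * trace φ₂ := by
    intro R hR
    have hs : Ioc 0 R ⊆ Ioi (0 : ℝ) := fun x hx => hx.1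
    have k₁ : IntegrableOn (fun x => starRingEnd ℂ (ψ₁ x)) (Ioc 0 R) :=
      (LinearIsometryEquiv.integrable_comp_iff Complex.conjLIE).mpr (ψ₁.integrableOn_Ioc R)
    have k₂ := ψ₂.integrableOn_Ioc R
    have key := integral_mul_primitive_add k₁ k₂
    have l₁ : IntegrableOn (fun x => starRingEnd ℂ (ψ₁ x) * ∫ t in Ioc 0 x, ψ₂ t) (Ioc 0 R) := by
      refine ((i₁.mono_set hs).sub (k₁.mul_const (trace φ₂))).congr
        (Eventually.of_forall fun x => ?_)
      simp only [hg₂, Pi.sub_apply]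
      ring
    have l₂ : IntegrableOn (fun x => (∫ t in Ioc 0 x, starRingEnd ℂ (ψ₁ t)) * ψ₂ x) (Ioc 0 R) := by
      refine ((i₂.mono_set hs).sub (k₂.const_mul (starRingEnd ℂ (trace φ₁)))).congr
        (Eventually.of_forall fun x => ?_)
      simp only [hg₁, Pi.sub_apply, map_add, integral_conj]
      ring
    rw [intervalIntegral.integral_of_le hR, integral_add (i₁.mono_set hs) (i₂.mono_set hs)]
    have m₁ : ∫ x in Ioc 0 R, starRingEnd ℂ (ψ₁ x) * g₂ x
        = (∫ x in Ioc 0 R, starRingEnd ℂ (ψ₁ x)) * trace φ₂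
          + ∫ x in Ioc 0 R, starRingEnd ℂ (ψ₁ x) * ∫ t in Ioc 0 x, ψ₂ t := by
      rw [← integral_mul_const, ← integral_add (k₁.mul_const _) l₁]
      simp only [hg₂, mul_add]
    have m₂ : ∫ x in Ioc 0 R, starRingEnd ℂ (g₁ x) * ψ₂ x
        = starRingEnd ℂ (trace φ₁) * (∫ x in Ioc 0 R, ψ₂ x)
          + ∫ x in Ioc 0 R, (∫ t in Ioc 0 x, starRingEnd ℂ (ψ₁ t)) * ψ₂ x := by
      rw [← integral_const_mul, ← integral_add (k₂.const_mul _) l₂]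
      simp only [hg₁, map_add, integral_conj, add_mul]
    rw [m₁, m₂]
    simp only [hg₁, hg₂, map_add, ← integral_conj]
    linear_combination key
  have hlim := intervalIntegral_tendsto_integral_Ioi 0 (i₁.add i₂) tendsto_id
  have hlim' : Tendsto (fun R => starRingEnd ℂ (g₁ R) * g₂ R) atTop
      (𝓝 (inner ℂ ψ₁ φ₂ + inner ℂ φ₁ ψ₂ + starRingEnd ℂ (trace φ₁) * trace φ₂)) := by
    rw [hl]
    refine (hlim.add_const (starRingEnd ℂ (trace φ₁) * trace φ₂)).congr' ?_
    filter_upwards [eventually_ge_atTop 0] with R h0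
    have := hR R h0
    simp only [id, Pi.add_apply]
    rw [this, sub_add_cancel]
  -- The boundary term at infinity has a limit and is integrable, so the limit is zero.
  have h0 := IntegrableAtFilter.eq_zero_of_tendsto ⟨Ioi 0, Ioi_mem_atTop 0, i₃⟩ (fun s hs => by
    obtain ⟨b, hb⟩ := mem_atTop_sets.mp hs
    rw [← top_le_iff, ← Real.volume_Ici (a := b)]
    exact measure_mono hb) hlim'
  exact eq_neg_of_add_eq_zero_left h0

/-- The trace inequality. -/
lemma HasWeakDeriv.norm_trace_sq_le {φ ψ : L2} (h : HasWeakDeriv φ ψ) :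
    ‖trace φ‖ ^ 2 ≤ 2 * (‖φ‖ * ‖ψ‖) := by
  have h1 := congrArg norm (h.inner_add_inner h)
  rw [norm_neg, norm_mul, RCLike.norm_conj, ← sq] at h1
  rw [← h1, two_mul]
  refine (norm_add_le _ _).trans (add_le_add ?_ (norm_inner_le_norm _ _))
  rw [mul_comm ‖φ‖]
  exact norm_inner_le_norm _ _

/-! ### Smooth functions with compact support -/

/-- The restriction to the half line of a compactly supported smooth function on the line lies in
`H¹`, and has its pointwise derivative as weak derivative. -/
lemma hasWeakDeriv_of_contDiff {η : ℝ → ℂ} (hη : ContDiff ℝ ∞ η) (hc : HasCompactSupport η)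
    {φ ψ : L2} (hφ : φ =ᵐ[volume.restrict (Ioi (0 : ℝ))] η)
    (hψ : ψ =ᵐ[volume.restrict (Ioi (0 : ℝ))] deriv η) : HasWeakDeriv φ ψ := by
  intro f hf hfc hs
  have hd : Continuous (deriv η) := hη.continuous_deriv (by simp)
  have hfd : Continuous (deriv f) := hf.continuous_deriv (by simp)
  have e1 : ∫ x in Ioi (0 : ℝ), deriv f x • φ x = ∫ x in Ioi (0 : ℝ), deriv f x • η x := by
    refine integral_congr_ae ?_
    filter_upwards [hφ] with x hx
    rw [hx]
  have e2 : ∫ x in Ioi (0 : ℝ), f x • ψ x = ∫ x in Ioi (0 : ℝ), f x • deriv η x := by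
    refine integral_congr_ae ?_
    filter_upwards [hψ] with x hx
    rw [hx]
  have i1 : Integrable (fun x => deriv f x • η x) (volume.restrict (Ioi (0 : ℝ))) :=
    ((hfd.smul hη.continuous).integrable_of_hasCompactSupport hc.smul_left).restrict
  have i2 : Integrable (fun x => f x • deriv η x) (volume.restrict (Ioi (0 : ℝ))) :=
    ((hf.continuous.smul hd).integrable_of_hasCompactSupport hc.deriv.smul_left).restrict
  have hprod : ∀ x, deriv (f • η) x = f x • deriv η x + deriv f x • η x := fun x =>
    deriv_smul (hf.differentiable (by simp) x) (hη.differentiable (by simp) x)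
  have hsm : HasCompactSupport (f • η) := hc.smul_left
  have key := hsm.integral_Ioi_deriv_eq ((hf.smul hη).of_le (by simp)) 0
  have hf0 : f 0 = 0 := image_eq_zero_of_notMem_tsupport fun h => lt_irrefl (0 : ℝ) (hs h)
  simp only [hprod] at key
  rw [integral_add i2 i1, Pi.smul_apply', hf0, zero_smul, neg_zero] at key
  rw [e1, e2]
  exact eq_neg_of_add_eq_zero_right key

lemma trace_eq_of_continuous {η : ℝ → ℂ} (hη : Continuous η) {φ : L2}
    (hφ : φ =ᵐ[volume.restrict (Ioi (0 : ℝ))] η) : trace φ = η 0 :=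
  HasTrace.trace_eq ⟨η, hη.continuousOn, (ae_restrict_iff' measurableSet_Ioi).mp hφ,
    (hη.tendsto 0).mono_left nhdsWithin_le_nhds⟩

lemma memLp_ofReal {f : ℝ → ℝ} (hf : Continuous f) (hc : HasCompactSupport f) :
    MemLp (fun x => (f x : ℂ)) 2 (volume.restrict (Ioi (0 : ℝ))) :=
  ((Complex.continuous_ofReal.comp hf).memLp_of_hasCompactSupport
    (hc.comp_left Complex.ofReal_zero)).restrict _

/-- The element of `L²` defined by a real continuous function with compact support. -/
noncomputable def testLp (f : ℝ → ℝ) (hf : Continuous f) (hc : HasCompactSupport f) : L2 :=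
  (memLp_ofReal hf hc).toLp _

lemma coeFn_testLp {f : ℝ → ℝ} (hf : Continuous f) (hc : HasCompactSupport f) :
    testLp f hf hc =ᵐ[volume.restrict (Ioi (0 : ℝ))] fun x => (f x : ℂ) :=
  (memLp_ofReal hf hc).coeFn_toLp

lemma inner_testLp {f : ℝ → ℝ} (hf : Continuous f) (hc : HasCompactSupport f) (φ : L2) :
    inner ℂ (testLp f hf hc) φ = ∫ x in Ioi (0 : ℝ), f x • φ x := by
  rw [L2.inner_def]
  refine integral_congr_ae ?_
  filter_upwards [coeFn_testLp hf hc] with x hx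
  rw [RCLike.inner_apply', hx, Complex.conj_ofReal, Complex.real_smul]

lemma hasWeakDeriv_iff_inner {φ ψ : L2} : HasWeakDeriv φ ψ ↔
    ∀ (f : ℝ → ℝ) (hf : ContDiff ℝ ∞ f) (hc : HasCompactSupport f), tsupport f ⊆ Ioi 0 →
      inner ℂ (testLp (deriv f) (hf.continuous_deriv (by simp)) hc.deriv) φ
        = -inner ℂ (testLp f hf.continuous hc) ψ := by
  simp only [inner_testLp, HasWeakDeriv]

lemma hasWeakDeriv_testLp {f : ℝ → ℝ} (hf : ContDiff ℝ ∞ f) (hc : HasCompactSupport f) :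
    HasWeakDeriv (testLp f hf.continuous hc)
      (testLp (deriv f) (hf.continuous_deriv (by simp)) hc.deriv) := by
  have e : deriv (fun x => (f x : ℂ)) = fun x => ((deriv f x : ℝ) : ℂ) := funext fun x =>
    ((hf.differentiable (by simp) x).hasDerivAt.ofReal_comp).deriv
  refine hasWeakDeriv_of_contDiff (η := fun x => (f x : ℂ)) (Complex.ofRealCLM.contDiff.comp hf)
    (hc.comp_left Complex.ofReal_zero) (coeFn_testLp _ _) ?_
  rw [e]
  exact coeFn_testLp _ _

lemma trace_testLp {f : ℝ → ℝ} (hf : Continuous f) (hc : HasCompactSupport f) :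
    trace (testLp f hf hc) = f 0 :=
  trace_eq_of_continuous (Complex.continuous_ofReal.comp hf) (coeFn_testLp hf hc)

lemma exists_trace_eq (a : ℂ) : ∃ φ ∈ H1, trace φ = a := by
  let b : ContDiffBump (0 : ℝ) := ⟨1, 2, by norm_num, by norm_num⟩
  have h : testLp b b.continuous b.hasCompactSupport ∈ H1 :=
    ⟨_, hasWeakDeriv_testLp b.contDiff b.hasCompactSupport⟩
  refine ⟨a • _, H1.smul_mem a h, ?_⟩
  rw [trace_smul a h, trace_testLp,
    b.one_of_mem_closedBall (Metric.mem_closedBall_self b.rIn_pos.le)]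
  simp

/-! ### The form domain as a Hilbert space -/

lemma HasWeakDeriv.sub {φ₁ φ₂ ψ₁ ψ₂ : L2} (h₁ : HasWeakDeriv φ₁ ψ₁) (h₂ : HasWeakDeriv φ₂ ψ₂) :
    HasWeakDeriv (φ₁ - φ₂) (ψ₁ - ψ₂) := by
  simpa [sub_eq_add_neg] using h₁.add (h₂.smul (-1))

lemma isClosed_hasWeakDeriv : IsClosed {p : L2 × L2 | HasWeakDeriv p.1 p.2} := by
  simp only [hasWeakDeriv_iff_inner, ofPred_forall]
  refine isClosed_iInter fun f => isClosed_iInter fun hf => isClosed_iInter fun hc =>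
    isClosed_iInter fun _ => isClosed_eq ?_ ?_
  · exact continuous_const.inner continuous_fst
  · exact (continuous_const.inner continuous_snd).neg

section FormSpace

variable {𝔥 : Type*} [NormedAddCommGroup 𝔥] [InnerProductSpace ℂ 𝔥]

/-- The form domain, as the space of the triples `(φ', (φ, y))`. Recording `φ'` makes it a closed
subspace of a Hilbert space, whose norm is the `H¹` norm of `φ` together with the norm of `y`. The
boundary condition `φ(0+) = ⟨w, y⟩` is imposed only for `θ = 0`. -/
def formSpace (w : 𝔥) (θ : ℝ) : Submodule ℂ (WithLp 2 (L2 × Space 𝔥)) where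
  carrier := {v | HasWeakDeriv v.snd.fst v.fst ∧
    (θ = 0 → trace v.snd.fst = inner ℂ w v.snd.snd)}
  zero_mem' := ⟨hasWeakDeriv_zero, fun _ => by simp [trace_zero]⟩
  add_mem' := by
    rintro u v ⟨hu, eu⟩ ⟨hv, ev⟩
    refine ⟨hu.add hv, fun h => ?_⟩
    simp only [WithLp.add_snd, WithLp.add_fst]
    rw [trace_add ⟨_, hu⟩ ⟨_, hv⟩, inner_add_right, eu h, ev h]
  smul_mem' := by
    rintro c v ⟨hv, ev⟩
    refine ⟨hv.smul c, fun h => ?_⟩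
    simp only [WithLp.smul_snd, WithLp.smul_fst]
    rw [trace_smul c ⟨_, hv⟩, inner_smul_right, ev h]

lemma norm_trace_le {φ ψ : L2} (h : HasWeakDeriv φ ψ) : ‖trace φ‖ ≤ ‖φ‖ + ‖ψ‖ := by
  have h1 := h.norm_trace_sq_le
  refine le_of_sq_le_sq ?_ (by positivity)
  nlinarith [sq_nonneg ‖φ‖, sq_nonneg ‖ψ‖]

lemma isClosed_formSpace (w : 𝔥) (θ : ℝ) :
    IsClosed (formSpace w θ : Set (WithLp 2 (L2 × Space 𝔥))) := by
  refine IsSeqClosed.isClosed fun v x hv hx => ?_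
  have h1 : Tendsto (fun n => (v n).fst) atTop (𝓝 x.fst) :=
    ((WithLp.fstL 2 ℂ L2 (Space 𝔥)).continuous.tendsto x).comp hx
  have h2 : Tendsto (fun n => (v n).snd) atTop (𝓝 x.snd) :=
    ((WithLp.sndL 2 ℂ L2 (Space 𝔥)).continuous.tendsto x).comp hx
  have h3 : Tendsto (fun n => (v n).snd.fst) atTop (𝓝 x.snd.fst) :=
    ((WithLp.fstL 2 ℂ L2 𝔥).continuous.tendsto x.snd).comp h2
  have h4 : Tendsto (fun n => (v n).snd.snd) atTop (𝓝 x.snd.snd) :=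
    ((WithLp.sndL 2 ℂ L2 𝔥).continuous.tendsto x.snd).comp h2
  have hx' : HasWeakDeriv x.snd.fst x.fst :=
    isClosed_hasWeakDeriv.mem_of_tendsto (h3.prodMk_nhds h1)
      (Eventually.of_forall fun n => (hv n).1)
  refine ⟨hx', fun h => ?_⟩
  have h5 : Tendsto (fun n => trace ((v n).snd.fst)) atTop (𝓝 (trace x.snd.fst)) := by
    rw [tendsto_iff_norm_sub_tendsto_zero]
    have h6 := (tendsto_iff_norm_sub_tendsto_zero.mp h3).add
      (tendsto_iff_norm_sub_tendsto_zero.mp h1)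
    rw [add_zero] at h6
    refine squeeze_zero (fun _ => norm_nonneg _) (fun n => ?_) h6
    have e := norm_trace_le ((hv n).1.sub hx')
    have e' := trace_add (φ₁ := (v n).snd.fst - x.snd.fst) ⟨_, (hv n).1.sub hx'⟩ ⟨_, hx'⟩
    rw [sub_add_cancel] at e'
    rwa [e', add_sub_cancel_right]
  refine tendsto_nhds_unique h5 ?_
  simp only [fun n => (hv n).2 h]
  exact tendsto_const_nhds.inner h4

variable (w : 𝔥) (θ : ℝ)

/-- The Hilbert space `formSpace w θ` as a type of its own, so that its topology and module
structure are those derived from its norm and inner product. -/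
def FormSpace : Type _ := formSpace w θ

noncomputable instance : NormedAddCommGroup (FormSpace w θ) :=
  inferInstanceAs (NormedAddCommGroup (formSpace w θ))

noncomputable instance : InnerProductSpace ℂ (FormSpace w θ) :=
  inferInstanceAs (InnerProductSpace ℂ (formSpace w θ))

instance [CompleteSpace 𝔥] : CompleteSpace (FormSpace w θ) :=
  (isClosed_formSpace w θ).completeSpace_coe

/-- The embedding `(φ', (φ, y)) ↦ (φ, y)`. -/
noncomputable def formEmbedding : FormSpace w θ →L[ℂ] Space 𝔥 :=
  WithLp.sndL 2 ℂ L2 (Space 𝔥) ∘L (formSpace w θ).subtypeL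

/-- The map `(φ', (φ, y)) ↦ φ'`. -/
noncomputable def formDeriv : FormSpace w θ →L[ℂ] L2 :=
  WithLp.fstL 2 ℂ L2 (Space 𝔥) ∘L (formSpace w θ).subtypeL

variable {w θ}

lemma hasWeakDeriv_formDeriv (v : FormSpace w θ) :
    HasWeakDeriv (formEmbedding w θ v).fst (formDeriv w θ v) := v.2.1

lemma FormSpace.norm_sq_eq (v : FormSpace w θ) : ‖v‖ ^ 2 =
    ‖formDeriv w θ v‖ ^ 2 +
      (‖(formEmbedding w θ v).fst‖ ^ 2 + ‖(formEmbedding w θ v).snd‖ ^ 2) := by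
  rw [← WithLp.prod_norm_sq_eq_of_L2]
  exact WithLp.prod_norm_sq_eq_of_L2 v.1

variable (w θ) in
/-- The boundary value `(φ', (φ, y)) ↦ φ(0+)`. -/
noncomputable def formTrace : FormSpace w θ →L[ℂ] ℂ :=
  LinearMap.mkContinuous
    { toFun := fun v => trace (formEmbedding w θ v).fst
      map_add' := fun u v => trace_add ⟨_, hasWeakDeriv_formDeriv u⟩ ⟨_, hasWeakDeriv_formDeriv v⟩
      map_smul' := fun c v => trace_smul c ⟨_, hasWeakDeriv_formDeriv v⟩ } 1 (fun v => by
    rw [one_mul]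
    refine le_of_sq_le_sq ?_ (norm_nonneg _)
    refine (hasWeakDeriv_formDeriv v).norm_trace_sq_le.trans ?_
    rw [FormSpace.norm_sq_eq]
    nlinarith [sq_nonneg (‖(formEmbedding w θ v).fst‖ - ‖formDeriv w θ v‖),
      sq_nonneg ‖(formEmbedding w θ v).snd‖])

lemma FormSpace.exists_lift {Ψ : Space 𝔥} {ψ : L2} (h : HasWeakDeriv Ψ.fst ψ)
    (hb : θ = 0 → trace Ψ.fst = inner ℂ w Ψ.snd) :
    ∃ v : FormSpace w θ, formDeriv w θ v = ψ ∧ formEmbedding w θ v = Ψ :=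
  ⟨⟨WithLp.toLp 2 (ψ, Ψ), h, hb⟩, rfl, rfl⟩

lemma FormSpace.exists_triple {φ ψ : L2} {y : 𝔥} (h : HasWeakDeriv φ ψ)
    (hb : θ = 0 → trace φ = inner ℂ w y) :
    ∃ v : FormSpace w θ, formDeriv w θ v = ψ ∧ (formEmbedding w θ v).fst = φ ∧
      (formEmbedding w θ v).snd = y :=
  ⟨⟨WithLp.toLp 2 (ψ, WithLp.toLp 2 (φ, y)), h, hb⟩, rfl, rfl, rfl⟩

lemma inner_space (Ψ Φ : Space 𝔥) :
    inner ℂ Ψ Φ = inner ℂ Ψ.fst Φ.fst + inner ℂ Ψ.snd Φ.snd := rfl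

lemma inner_space_toLp (Ψ : Space 𝔥) (φ : L2) (y : 𝔥) :
    inner ℂ Ψ (WithLp.toLp 2 (φ, y)) = inner ℂ Ψ.fst φ + inner ℂ Ψ.snd y := rfl

lemma injective_formEmbedding : Function.Injective (formEmbedding w θ) := by
  intro u v h
  have h' : formDeriv w θ u = formDeriv w θ v := by
    have := hasWeakDeriv_formDeriv u
    rw [h] at this
    exact this.unique (hasWeakDeriv_formDeriv v)
  refine Subtype.ext ((WithLp.equiv 2 _).injective (Prod.ext h' h))

lemma range_formEmbedding : range (formEmbedding w θ) =
    {Ψ : Space 𝔥 | Ψ.fst ∈ H1 ∧ (θ = 0 → trace Ψ.fst = inner ℂ w Ψ.snd)} := by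
  ext Ψ
  constructor
  · rintro ⟨v, rfl⟩
    exact ⟨⟨_, hasWeakDeriv_formDeriv v⟩, v.2.2⟩
  · rintro ⟨⟨ψ, hψ⟩, hb⟩
    obtain ⟨v, -, hv⟩ := FormSpace.exists_lift hψ hb
    exact ⟨v, hv⟩

variable (w θ) in
/-- The defect `(φ', (φ, y)) ↦ φ(0+) - ⟨w, y⟩` in the boundary condition of the form. -/
noncomputable def boundaryDefect : FormSpace w θ →L[ℂ] ℂ :=
  formTrace w θ - innerSL ℂ w ∘L WithLp.sndL 2 ℂ L2 𝔥 ∘L formEmbedding w θ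

lemma boundaryDefect_apply (v : FormSpace w θ) : boundaryDefect w θ v =
    trace (formEmbedding w θ v).fst - inner ℂ w (formEmbedding w θ v).snd := rfl

lemma lambOperator_apply {L : 𝔥 →ₗ[ℂ] 𝔥} {Ψ : Space 𝔥} (h : Ψ ∈ (lambOperator L w θ).domain) :
    lambOperator L w θ ⟨Ψ, h⟩ = WithLp.toLp 2 (weakDeriv (weakDeriv Ψ.fst),
      L Ψ.snd + trace (weakDeriv Ψ.fst) • w) := rfl

/-! ### The form -/

variable [FiniteDimensional ℂ 𝔥] [CompleteSpace 𝔥]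

variable (w θ) in
/-- The bounded operator `B` on the form domain which represents the form
`⟨φ₁', φ₂'⟩ - ⟨y₁, L y₂⟩ - θ⁻¹ conj (φ₁(0+) - ⟨w, y₁⟩) (φ₂(0+) - ⟨w, y₂⟩)`. For `θ = 0` the
convention `0⁻¹ = 0` removes the last term, which then vanishes anyway by the boundary
condition. -/
noncomputable def formMap (L : 𝔥 →ₗ[ℂ] 𝔥) : FormSpace w θ →L[ℂ] FormSpace w θ :=
  (formDeriv w θ).adjoint ∘L formDeriv w θ
    - (WithLp.sndL 2 ℂ L2 𝔥 ∘L formEmbedding w θ).adjoint ∘L LinearMap.toContinuousLinearMap L ∘L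
      WithLp.sndL 2 ℂ L2 𝔥 ∘L formEmbedding w θ
    - ((θ⁻¹ : ℝ) : ℂ) • (boundaryDefect w θ).adjoint ∘L boundaryDefect w θ

variable {L : 𝔥 →ₗ[ℂ] 𝔥}

lemma inner_formMap (u v : FormSpace w θ) : inner ℂ u (formMap w θ L v) =
    inner ℂ (formDeriv w θ u) (formDeriv w θ v)
      - inner ℂ (formEmbedding w θ u).snd (L (formEmbedding w θ v).snd)
      - ((θ⁻¹ : ℝ) : ℂ) * (starRingEnd ℂ (boundaryDefect w θ u) * boundaryDefect w θ v) := by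
  simp only [formMap, sub_apply, smul_apply, ContinuousLinearMap.comp_apply, inner_sub_right,
    inner_smul_right, ContinuousLinearMap.adjoint_inner_right]
  rw [RCLike.inner_apply']
  rfl

lemma isSymmetric_formMap (hL : L.IsSymmetric) :
    (formMap w θ L : FormSpace w θ →ₗ[ℂ] FormSpace w θ).IsSymmetric := by
  intro u v
  change inner ℂ (formMap w θ L u) v = inner ℂ u (formMap w θ L v)
  rw [← inner_conj_symm, inner_formMap, inner_formMap, map_sub, map_sub, map_mul, map_mul,
    inner_conj_symm, inner_conj_symm, hL, Complex.conj_ofReal, Complex.conj_conj,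
    mul_comm (boundaryDefect w θ v)]

lemma re_inner_formMap (v : FormSpace w θ) : (inner ℂ v (formMap w θ L v)).re =
    ‖formDeriv w θ v‖ ^ 2 - (inner ℂ (formEmbedding w θ v).snd (L (formEmbedding w θ v).snd)).re
      - θ⁻¹ * ‖boundaryDefect w θ v‖ ^ 2 := by
  have h : (inner ℂ (formDeriv w θ v) (formDeriv w θ v)).re = ‖formDeriv w θ v‖ ^ 2 :=
    inner_self_eq_norm_sq (𝕜 := ℂ) _
  rw [inner_formMap, Complex.sub_re, Complex.sub_re, Complex.re_ofReal_mul, h,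
    ← Complex.normSq_eq_conj_mul_self, Complex.ofReal_re, Complex.normSq_eq_norm_sq]

variable (w θ L) in
lemma exists_coerciveBound :
    ∃ c, IsFormOperator.CoerciveBound (formEmbedding w θ) (formMap w θ L) (1 / 2) c := by
  set L' := LinearMap.toContinuousLinearMap L with hL'
  -- Up to a multiple of `‖y‖²`, the boundary term is at most
  -- `4 |θ⁻¹| ‖φ‖ ‖ψ‖ ≤ ‖ψ‖² / 2 + 8 |θ⁻¹|² ‖φ‖²`.
  refine ⟨1 + 8 * |θ⁻¹| ^ 2 + ‖L'‖ + 2 * |θ⁻¹| * ‖w‖ ^ 2, fun v => ?_⟩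
  rw [re_inner_formMap, FormSpace.norm_sq_eq, WithLp.prod_norm_sq_eq_of_L2, boundaryDefect_apply]
  have h1 := (hasWeakDeriv_formDeriv v).norm_trace_sq_le
  set ψ := formDeriv w θ v
  set φ := (formEmbedding w θ v).fst
  set y := (formEmbedding w θ v).snd
  have h2 : (inner ℂ y (L y)).re ≤ ‖L'‖ * ‖y‖ ^ 2 := by
    refine (Complex.re_le_norm _).trans ((norm_inner_le_norm _ _).trans ?_)
    have : ‖L y‖ ≤ ‖L'‖ * ‖y‖ := L'.le_opNorm y
    nlinarith [norm_nonneg y]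
  have h3 : ‖trace φ - inner ℂ w y‖ ^ 2 ≤ 4 * (‖φ‖ * ‖ψ‖) + 2 * (‖w‖ ^ 2 * ‖y‖ ^ 2) := by
    have e1 : ‖trace φ - inner ℂ w y‖ ≤ ‖trace φ‖ + ‖w‖ * ‖y‖ :=
      (norm_sub_le _ _).trans (add_le_add_right (norm_inner_le_norm _ _) _)
    have e2 := pow_le_pow_left₀ (norm_nonneg _) e1 2
    nlinarith [sq_nonneg (‖trace φ‖ - ‖w‖ * ‖y‖)]
  have h4 : θ⁻¹ * ‖trace φ - inner ℂ w y‖ ^ 2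
      ≤ |θ⁻¹| * (4 * (‖φ‖ * ‖ψ‖) + 2 * (‖w‖ ^ 2 * ‖y‖ ^ 2)) :=
    mul_le_mul (le_abs_self _) h3 (sq_nonneg _) (abs_nonneg _)
  set K := |θ⁻¹|
  have h5 : 0 ≤ ‖L'‖ * ‖φ‖ ^ 2 := by positivity
  have h6 : 0 ≤ K * ‖w‖ ^ 2 * ‖φ‖ ^ 2 := by positivity
  have h7 : 0 ≤ K ^ 2 * ‖y‖ ^ 2 := by positivity
  have h8 := sq_nonneg (‖ψ‖ - 4 * K * ‖φ‖)
  nlinarith [sq_nonneg ‖φ‖, sq_nonneg ‖y‖]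

/-! ### The operator of the form -/

/-- The form represents `-A` on the domain of `A`. -/
lemma inner_formMap_of_mem_domain (x : (lambOperator L w θ).domain) :
    ∃ v, formEmbedding w θ v = x ∧ ∀ u, inner ℂ u (formMap w θ L v)
      = inner ℂ (formEmbedding w θ u) (-lambOperator L w θ x) := by
  obtain ⟨Ψ, hmem⟩ := x
  have hΨ : Ψ.fst ∈ H2 := hmem.1
  have hb : (θ : ℂ) * trace (weakDeriv Ψ.fst) + trace Ψ.fst = inner ℂ w Ψ.snd := hmem.2
  have h1 := hasWeakDeriv_weakDeriv hΨ.1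
  have h2 := hasWeakDeriv_weakDeriv hΨ.2
  obtain ⟨v, hv, hv'⟩ := FormSpace.exists_lift (w := w) (θ := θ) h1
    (fun h => by simpa [h] using hb)
  refine ⟨v, hv', fun u => ?_⟩
  have key := (hasWeakDeriv_formDeriv u).inner_add_inner h2
  rw [inner_formMap, lambOperator_apply hmem, hv, hv', boundaryDefect_apply v, hv', inner_neg_right,
    inner_space_toLp, inner_add_right, inner_smul_right]
  set t := trace (weakDeriv Ψ.fst)
  set z := (formEmbedding w θ u).snd with hz
  have hc : starRingEnd ℂ (boundaryDefect w θ u)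
      = starRingEnd ℂ (trace (formEmbedding w θ u).fst) - inner ℂ z w := by
    rw [boundaryDefect_apply, map_sub, inner_conj_symm]
  have hd : ((θ⁻¹ : ℝ) : ℂ) *
      (starRingEnd ℂ (boundaryDefect w θ u) * (trace Ψ.fst - inner ℂ w Ψ.snd))
      = -(starRingEnd ℂ (boundaryDefect w θ u) * t) := by
    have e : trace Ψ.fst - inner ℂ w Ψ.snd = -(θ * t) := by linear_combination hb
    rcases eq_or_ne θ 0 with h | h
    · have h0 : boundaryDefect w θ u = 0 := by
        rw [boundaryDefect_apply, sub_eq_zero]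
        exact u.2.2 h
      rw [h0]
      simp
    · have h' : (θ : ℂ) ≠ 0 := by exact_mod_cast h
      rw [e, Complex.ofReal_inv]
      field_simp
  rw [hd, hc]
  linear_combination key

/-- Conversely, an element of the form domain on which the form is represented by a vector `F` lies
in the domain of `A`. Testing against compactly supported functions gives `φ'' = -F₁`; the boundary
terms then give the second component of `A` and the boundary condition. -/
lemma mem_domain_of_inner_formMap {v : FormSpace w θ} {F : Space 𝔥}
    (h : ∀ u, inner ℂ u (formMap w θ L v) = inner ℂ (formEmbedding w θ u) F) :
    ∃ x : (lambOperator L w θ).domain, (x : Space 𝔥) = formEmbedding w θ v ∧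
      -lambOperator L w θ x = F := by
  set ψ := formDeriv w θ v with hψ
  set Ψ := formEmbedding w θ v with hΨ
  have hφ : HasWeakDeriv Ψ.fst ψ := hasWeakDeriv_formDeriv v
  have hψ' : HasWeakDeriv ψ (-F.fst) := by
    refine hasWeakDeriv_iff_inner.mpr fun f hf hc hs => ?_
    have hf0 : f 0 = 0 := image_eq_zero_of_notMem_tsupport fun h => lt_irrefl (0 : ℝ) (hs h)
    have ht : trace (testLp f hf.continuous hc) = 0 := by
      rw [trace_testLp, hf0, Complex.ofReal_zero]
    obtain ⟨u, hu, hu', hu''⟩ := FormSpace.exists_triple (w := w) (θ := θ) (y := 0)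
      (hasWeakDeriv_testLp hf hc) (fun _ => by rw [ht, inner_zero_right])
    have h1 := h u
    rw [inner_formMap, boundaryDefect_apply u, inner_space, hu, hu', hu''] at h1
    simp only [ht, inner_zero_right, inner_zero_left, sub_zero, map_zero, zero_mul, mul_zero,
      add_zero] at h1
    rw [inner_neg_right, neg_neg, hψ, h1]
  set t := trace ψ with ht
  have hbdry : ∀ u, -(starRingEnd ℂ (trace (formEmbedding w θ u).fst) * t)
      - inner ℂ (formEmbedding w θ u).snd (L Ψ.snd)
      - ((θ⁻¹ : ℝ) : ℂ) * (starRingEnd ℂ (boundaryDefect w θ u) * boundaryDefect w θ v)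
      = inner ℂ (formEmbedding w θ u).snd F.snd := by
    intro u
    have h1 := h u
    have h2 := (hasWeakDeriv_formDeriv u).inner_add_inner hψ'
    rw [inner_formMap, inner_space] at h1
    rw [inner_neg_right] at h2
    linear_combination h1 - h2
  have hsnd : F.snd = -(L Ψ.snd + t • w) := by
    refine ext_inner_left ℂ fun z => ?_
    -- A pair `(χ, z)` with `χ(0+) = ⟨w, z⟩` is admissible for every `θ` and kills the last term.
    obtain ⟨χ, ⟨χ', hχ⟩, hχt⟩ := exists_trace_eq (inner ℂ w z)
    obtain ⟨u, -, hu, hu'⟩ := FormSpace.exists_triple (w := w) (θ := θ) (y := z) hχ (fun _ => hχt)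
    have h1 := hbdry u
    rw [boundaryDefect_apply u, hu, hu'] at h1
    simp only [hχt, sub_self, map_zero, zero_mul, mul_zero, sub_zero, inner_conj_symm] at h1
    rw [← h1, inner_neg_right, inner_add_right, inner_smul_right]
    ring
  have hbc : (θ : ℂ) * t + trace Ψ.fst = inner ℂ w Ψ.snd := by
    rcases eq_or_ne θ 0 with h0 | h0
    · rw [h0, Complex.ofReal_zero, zero_mul, zero_add]
      exact v.2.2 h0
    · obtain ⟨χ, ⟨χ', hχ⟩, hχt⟩ := exists_trace_eq 1
      obtain ⟨u, -, hu, hu'⟩ := FormSpace.exists_triple (w := w) (θ := θ) (y := 0) hχ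
        (fun h => absurd h h0)
      have h1 := hbdry u
      rw [boundaryDefect_apply u, boundaryDefect_apply v, hu, hu'] at h1
      simp only [hχt, inner_zero_right, inner_zero_left, sub_zero, map_one, one_mul] at h1
      have h' : (θ : ℂ) ≠ 0 := by exact_mod_cast h0
      rw [Complex.ofReal_inv] at h1
      field_simp at h1
      linear_combination -h1
  have hd : weakDeriv Ψ.fst = ψ := hφ.weakDeriv_eq
  have hmem : Ψ ∈ (lambOperator L w θ).domain :=
    ⟨⟨⟨ψ, hφ⟩, hd ▸ ⟨_, hψ'⟩⟩, by rw [hd]; exact hbc⟩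
  refine ⟨⟨Ψ, hmem⟩, rfl, ?_⟩
  rw [lambOperator_apply hmem, hd, hψ'.weakDeriv_eq, ← ht, ← neg_neg (L Ψ.snd + t • w), ← hsnd,
    ← WithLp.toLp_neg, Prod.neg_mk, neg_neg, neg_neg]
  rfl

variable (w θ L) in
lemma isFormOperator_neg_lambOperator :
    IsFormOperator (formEmbedding w θ) (formMap w θ L) (-lambOperator L w θ) := by
  intro x F
  rw [LinearPMap.mem_graph_iff]
  constructor
  · rintro ⟨x, rfl, rfl⟩
    exact inner_formMap_of_mem_domain x
  · rintro ⟨v, rfl, hv⟩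
    exact mem_domain_of_inner_formMap hv

end FormSpace

end Lamb

theorem mainTheorem3 {𝔥 : Type*} [NormedAddCommGroup 𝔥] [InnerProductSpace ℂ 𝔥]
    [FiniteDimensional ℂ 𝔥] [CompleteSpace 𝔥]
    (L : 𝔥 →ₗ[ℂ] 𝔥) (hL : L.IsSymmetric) (w : 𝔥) (θ : ℝ) :
    -- `A` is self-adjoint and `-A` is bounded from below
    IsSelfAdjoint (Lamb.lambOperator L w θ) ∧
    (∃ c : ℝ, ∀ Ψ : (-Lamb.lambOperator L w θ).domain,
      c * ‖(Ψ : Lamb.Space 𝔥)‖ ^ 2 ≤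
        (inner ℂ (Ψ : Lamb.Space 𝔥) ((-Lamb.lambOperator L w θ) Ψ)).re) ∧
    -- the quadratic form of `-A` is well defined and closed
    (∀ (Ψ : Lamb.Space 𝔥) (q : ℝ), Lamb.IsFormValue (-Lamb.lambOperator L w θ) Ψ q →
      q = Lamb.quadForm (-Lamb.lambOperator L w θ) Ψ) ∧
    Lamb.IsClosedForm (Lamb.formDomain (-Lamb.lambOperator L w θ))
      (Lamb.quadForm (-Lamb.lambOperator L w θ)) ∧
    -- its explicit description
    (θ = 0 →
      Lamb.formDomain (-Lamb.lambOperator L w θ) =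
        {Ψ : Lamb.Space 𝔥 | Ψ.fst ∈ Lamb.H1 ∧ Lamb.trace Ψ.fst = inner ℂ w Ψ.snd} ∧
      ∀ Ψ ∈ Lamb.formDomain (-Lamb.lambOperator L w θ),
        Lamb.quadForm (-Lamb.lambOperator L w θ) Ψ =
          ‖Lamb.weakDeriv Ψ.fst‖ ^ 2 - (inner ℂ (L Ψ.snd) Ψ.snd).re) ∧
    (θ ≠ 0 →
      Lamb.formDomain (-Lamb.lambOperator L w θ) =
        {Ψ : Lamb.Space 𝔥 | Ψ.fst ∈ Lamb.H1} ∧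
      ∀ Ψ ∈ Lamb.formDomain (-Lamb.lambOperator L w θ),
        Lamb.quadForm (-Lamb.lambOperator L w θ) Ψ =
          ‖Lamb.weakDeriv Ψ.fst‖ ^ 2 - (inner ℂ (L Ψ.snd) Ψ.snd).re -
            θ⁻¹ * ‖Lamb.trace Ψ.fst - inner ℂ w Ψ.snd‖ ^ 2) := by
  obtain ⟨c, hc⟩ := Lamb.exists_coerciveBound w θ L
  have hδ : (0 : ℝ) < 1 / 2 := by norm_num
  have hB := Lamb.isSymmetric_formMap (w := w) (θ := θ) hL
  have hP := Lamb.injective_formEmbedding (w := w) (θ := θ)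
  have hT := Lamb.isFormOperator_neg_lambOperator w θ L
  have hdom := (hT.formDomain_eq hB hP hδ hc).trans Lamb.range_formEmbedding
  have hval : ∀ Ψ ∈ Lamb.formDomain (-Lamb.lambOperator L w θ),
      Lamb.quadForm (-Lamb.lambOperator L w θ) Ψ =
        ‖Lamb.weakDeriv Ψ.fst‖ ^ 2 - (inner ℂ (L Ψ.snd) Ψ.snd).re -
          θ⁻¹ * ‖Lamb.trace Ψ.fst - inner ℂ w Ψ.snd‖ ^ 2 := by
    intro Ψ hΨ
    rw [hT.formDomain_eq hB hP hδ hc] at hΨ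
    obtain ⟨v, rfl⟩ := hΨ
    rw [hT.quadForm_apply hB hP hδ hc, Lamb.re_inner_formMap,
      (Lamb.hasWeakDeriv_formDeriv v).weakDeriv_eq, hL, Lamb.boundaryDefect_apply]
  refine ⟨hT.isSelfAdjoint_neg hB hδ hc, ⟨-c, hT.bounded_below hδ hc⟩,
    fun Ψ q => hT.eq_quadForm hB hP hδ hc, hT.isClosedForm hB hP hδ hc, fun h => ⟨?_, ?_⟩,
    fun h => ⟨?_, hval⟩⟩
  · rw [hdom]
    simp [h]
  · intro Ψ hΨ
    rw [hval Ψ hΨ, h, inv_zero, zero_mul, sub_zero]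
  · rw [hdom]
    simp [h]
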